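/- Let $d\ge 0$ and let $\mathcal H$ be $L^2(\mathbb R^d)$ or $\ell^2(\mathbb Z^d)$. Let $H_0=-\Delta$ be the free Hamiltonian: on $L^2(\mathbb R^d)$ it has domain $H^2(\mathbb R^d)$; on $\ell^2(\mathbb Z^d)$ it is the bounded operator $(H_0\psi)(n)=\sum_{|m-n|_1=1}(\psi(n)-\psi(m))$ (the same assertions also hold for the other usual normalization $(H_0\psi)(n)=\sum_{|m-n|_1=1}\psi(m)$). Let $Q=(Q_1,\dots,Q_d)$ be the position operator, where $Q_j$ is multiplication by the $j$-th coordinate with domain $D(Q_j)=\{\psi\in\mathcal H: Q_j\psi\in\mathcal H\}$, and let $\Xi=(\Xi_1,\dots,\Xi_d)$ be the momentum operator, where $\Xi_j=-i[Q_j,H_0]$ with its maximal domain (the adjoint of $-i[Q_j,H_0]$ defined on the natural domain of the commutator). As operators $\mathcal H\to\mathcal H^d$, $D(Q)=\bigcap_jD(Q_j)$ and $D(\Xi)=\bigcap_jD(\Xi_j)$. Then $D(\Xi)=H^1(\mathbb R^d)$ in the continuum and $D(\Xi)=\mathcal H$ on the lattice. There is exactly one strongly continuous one-parameter unitary group $e^{-itH_0}$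 with infinitesimal generator $-iH_0$. Let $Q_j(t)=e^{itH_0}Q_je^{-itH_0}$ with domain $\{\psi: e^{-itH_0}\psi\in D(Q_j)\}$ and $Q(t)=(Q_1(t),\dots,Q_d(t))$ with domain $D(Q(t))=\bigcap_jD(Q_j(t))$. Then: 1. For every $t\in\mathbb R$, $D(Q)\cap D(\Xi)\subseteq D(Q(t))$ and $Q(t)\psi=Q\psi+t\,\Xi\psi$ for every $\psi\in D(Q)\cap D(\Xi)$. In the continuum, $Q(t)$ is the closure of the operator $Q+t\,\Xi$ with domain $D(Q)\cap D(\Xi)$; on the lattice, $Q(t)=Q+t\,\Xi$ as operators, with equality of domains. 2. For every $\psi\in D(Q)\cap D(\Xi)$, $\frac1tQ(t)\psi\to\Xi\psi$ in $\mathcal H^d$ as $t\to\infty$. 3. For every $j$, $\frac1tQ_j(t)\to\Xi_j$ in the strong resolvent sense as $t\to\infty$: the operators $\frac1tQ_j(t)$ ($t>0$) and $\Xi_j$ are self-adjoint, and $\left(\frac1tQ_j(t)-z\right)^{-1}\varphi\to(\Xi_j-z)^{-1}\varphi$ for every $z\in\mathbb C\setminus\mathbb R$ and every $\varphi\in\mathcal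 H$. -/

import Mathlib

open MeasureTheory Filter Topology
open scoped SchwartzMap Laplacian LineDeriv LinearPMap

noncomputable section

namespace Ballistic

/-! ## Unbounded operators on a Hilbert space -/

section Abstract

variable {E : Type*} [NormedAddCommGroup E] [InnerProductSpace ℂ E]

/-- The product `A B` of two unbounded operators on its natural domain
`{ψ ∈ D(B) : B ψ ∈ D(A)}`. -/
def comp (A B : E →ₗ.[ℂ] E) : E →ₗ.[ℂ] E where
  domain :=
    { carrier := {x | ∃ h : x ∈ B.domain, B ⟨x, h⟩ ∈ A.domain}
      zero_mem' := ⟨B.domain.zero_mem, by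
        have : B ⟨0, B.domain.zero_mem⟩ = 0 := B.map_zero
        rw [this]; exact A.domain.zero_mem⟩
      add_mem' := by
        rintro x y ⟨hx, hx'⟩ ⟨hy, hy'⟩
        refine ⟨B.domain.add_mem hx hy, ?_⟩
        have : B ⟨x + y, B.domain.add_mem hx hy⟩ = B ⟨x, hx⟩ + B ⟨y, hy⟩ :=
          B.map_add ⟨x, hx⟩ ⟨y, hy⟩
        rw [this]; exact A.domain.add_mem hx' hy'
      smul_mem' := by
        rintro c x ⟨hx, hx'⟩
        refine ⟨B.domain.smul_mem c hx, ?_⟩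
        have : B ⟨c • x, B.domain.smul_mem c hx⟩ = c • B ⟨x, hx⟩ := B.map_smul c ⟨x, hx⟩
        rw [this]; exact A.domain.smul_mem c hx' }
  toFun :=
    { toFun := fun x => A ⟨B ⟨x, x.2.1⟩, x.2.2⟩
      map_add' := by
        intro x y
        rw [← A.map_add]
        congr 1
        exact Subtype.ext (B.map_add ⟨x, x.2.1⟩ ⟨y, y.2.1⟩)
      map_smul' := by
        intro c x
        rw [RingHom.id_apply, ← A.map_smul]
        congr 1
        exact Subtype.ext (B.map_smul c ⟨x, x.2.1⟩) }

/-- The commutator `[A, B] = A B - B A` on its natural domain `D(A B) ∩ D(B A)`. -/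
def commutator (A B : E →ₗ.[ℂ] E) : E →ₗ.[ℂ] E := comp A B - comp B A

/-- `-i [A, B]` with its maximal domain (for symmetric `A`, `B`, so that `-i [A, B]` is formally
symmetric): `ψ` belongs to the domain, with image `φ`, iff
`⟪φ, χ⟫ = ⟪ψ, -i [A, B] χ⟫` for all `χ` in the natural domain of the commutator. -/
def maxCommutator [CompleteSpace E] (A B : E →ₗ.[ℂ] E) : E →ₗ.[ℂ] E :=
  ((-Complex.I) • commutator A B)†

/-- `U t = e^{-itH}`: `U` is the strongly continuous one-parameter unitary group whose
infinitesimal generator is exactly `-i H`. -/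
structure IsPropagator (H : E →ₗ.[ℂ] E) (U : ℝ → E →L[ℂ] E) : Prop where
  zero : U 0 = 1
  add : ∀ s t, U (s + t) = U s * U t
  isometry : ∀ t ψ, ‖U t ψ‖ = ‖ψ‖
  continuous : ∀ ψ, Continuous fun t => U t ψ
  generator : ∀ ψ φ, HasDerivAt (fun t => U t ψ) φ 0 ↔
    ∃ h : ψ ∈ H.domain, φ = (-Complex.I) • H ⟨ψ, h⟩

/-- The Heisenberg evolution `A(t) = e^{itH} A e^{-itH}`, where `U t = e^{-itH}`, on its natural
domain `{ψ : e^{-itH} ψ ∈ D(A)}`. -/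
def heisenberg (U : ℝ → E →L[ℂ] E) (A : E →ₗ.[ℂ] E) (t : ℝ) : E →ₗ.[ℂ] E where
  domain := A.domain.comap (U t : E →ₗ[ℂ] E)
  toFun := (U (-t) : E →ₗ[ℂ] E) ∘ₗ A.toFun ∘ₗ
    (U t : E →ₗ[ℂ] E).restrict (fun _ hx => hx)

/-- The vector of operators `A = (A₁, …, A_d)`, `ψ ↦ (A₁ ψ, …, A_d ψ)`, as an operator from
`E` to `E^d` with domain `⋂ j, D(A_j)`. -/
def vec {d : ℕ} (A : Fin d → E →ₗ.[ℂ] E) : E →ₗ.[ℂ] PiLp 2 (fun _ : Fin d => E) where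
  domain := ⨅ j, (A j).domain
  toFun := (WithLp.linearEquiv 2 ℂ (Fin d → E)).symm.toLinearMap ∘ₗ
    LinearMap.pi fun j => (A j).toFun ∘ₗ Submodule.inclusion (iInf_le _ j)

/-- The Heisenberg evolution `A(t) = e^{itH} A e^{-itH} = (A₁(t), …, A_d(t))` of a vector of
operators. -/
def vecHeisenberg {d : ℕ} (U : ℝ → E →L[ℂ] E) (A : Fin d → E →ₗ.[ℂ] E) (t : ℝ) :
    E →ₗ.[ℂ] PiLp 2 (fun _ : Fin d => E) :=
  vec fun j => heisenberg U (A j) t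

/-- `R = (A - z)⁻¹` is the (bounded, everywhere defined) resolvent of `A` at `z`. -/
def IsResolvent (A : E →ₗ.[ℂ] E) (z : ℂ) (R : E →L[ℂ] E) : Prop :=
  (∀ φ, ∃ h : R φ ∈ A.domain, A ⟨R φ, h⟩ - z • R φ = φ) ∧
  (∀ ψ : A.domain, R (A ψ - z • (ψ : E)) = ψ)

/-- `A t → B` in the strong resolvent sense along the filter `l`: the operators are self-adjoint
and `(A t - z)⁻¹ φ → (B - z)⁻¹ φ` for all nonreal `z` and all `φ`. -/
def StrongResolventTendsto [CompleteSpace E] {ι : Type*} (A : ι → E →ₗ.[ℂ] E) (l : Filter ι)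
    (B : E →ₗ.[ℂ] E) : Prop :=
  (∀ᶠ t in l, IsSelfAdjoint (A t)) ∧ IsSelfAdjoint B ∧
  ∀ z : ℂ, z.im ≠ 0 → ∃ (R : ι → E →L[ℂ] E) (R' : E →L[ℂ] E),
    (∀ᶠ t in l, IsResolvent (A t) z (R t)) ∧ IsResolvent B z R' ∧
    ∀ φ, Tendsto (fun t => R t φ) l (𝓝 (R' φ))

end Abstract

/-! ## The continuum: `L²(ℝ^d)` -/

/-- The Hilbert space `L²(ℝ^d)`. -/
abbrev L2 (d : ℕ) : Type := Lp ℂ 2 (volume : Measure (EuclideanSpace ℝ (Fin d)))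

/-- The domain `{ψ : x_j ψ ∈ L²}` of the `j`-th position operator on `L²(ℝ^d)`. -/
def positionDomain (d : ℕ) (j : Fin d) : Submodule ℂ (L2 d) where
  carrier := {ψ | MemLp (fun x => ((x j : ℝ) : ℂ) * ψ x) 2 volume}
  zero_mem' := by
    refine MemLp.ae_eq (f := 0) ?_ MemLp.zero
    filter_upwards [Lp.coeFn_zero ℂ 2 (volume : Measure (EuclideanSpace ℝ (Fin d)))] with x hx
    simp only [hx, Pi.zero_apply, mul_zero]
  add_mem' := by
    intro ψ φ hψ hφ
    refine MemLp.ae_eq ?_ (MemLp.add hψ hφ)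
    filter_upwards [Lp.coeFn_add ψ φ] with x hx
    simp only [hx, Pi.add_apply, mul_add]
  smul_mem' := by
    intro c ψ hψ
    refine MemLp.ae_eq ?_ (MemLp.const_smul hψ c)
    filter_upwards [Lp.coeFn_smul c ψ] with x hx
    simp only [hx, Pi.smul_apply, smul_eq_mul, mul_left_comm]

/-- The `j`-th position operator: multiplication by the coordinate `x_j` on `L²(ℝ^d)`. -/
def position (d : ℕ) (j : Fin d) : L2 d →ₗ.[ℂ] L2 d where
  domain := positionDomain d j
  toFun :=
    { toFun := fun ψ => MemLp.toLp (fun x => ((x j : ℝ) : ℂ) * (ψ : L2 d) x) ψ.2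
      map_add' := by
        intro ψ φ
        refine Eq.trans ?_ (MemLp.toLp_add ψ.2 φ.2)
        apply MemLp.toLp_congr
        filter_upwards [Lp.coeFn_add (ψ : L2 d) (φ : L2 d)] with x hx
        simp only [Submodule.coe_add, hx, Pi.add_apply, mul_add]
      map_smul' := by
        intro c ψ
        refine Eq.trans ?_ (MemLp.toLp_const_smul c ψ.2)
        apply MemLp.toLp_congr
        filter_upwards [Lp.coeFn_smul c (ψ : L2 d)] with x hx
        simp only [Submodule.coe_smul, hx, Pi.smul_apply, smul_eq_mul, mul_left_comm] }

/-- The tempered distribution defined by an `L²` function. -/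
def toDist (d : ℕ) : L2 d →ₗ[ℂ] 𝓢'(EuclideanSpace ℝ (Fin d), ℂ) :=
  (Lp.toTemperedDistributionCLM ℂ (volume : Measure (EuclideanSpace ℝ (Fin d))) 2).toLinearMap

/-- An `L²` function is determined by the tempered distribution that it defines. -/
theorem toDist_injective (d : ℕ) : Function.Injective (toDist d) :=
  LinearMap.ker_eq_bot.mp (Lp.ker_toTemperedDistributionCLM_eq_bot)

/-- The Sobolev space `H²(ℝ^d)` as a subspace of `L²(ℝ^d)`. -/
def sobolevTwo (d : ℕ) : Submodule ℂ (L2 d) where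
  carrier := {ψ | TemperedDistribution.MemSobolev 2 2 (toDist d ψ)}
  zero_mem' := by
    rw [Set.mem_ofPred_eq, map_zero]
    exact TemperedDistribution.memSobolev_fun_zero (EuclideanSpace ℝ (Fin d)) ℂ 2 2
  add_mem' := by
    intro ψ φ hψ hφ
    rw [Set.mem_ofPred_eq, map_add]
    exact TemperedDistribution.MemSobolev.add hψ hφ
  smul_mem' := by
    intro c ψ hψ
    rw [Set.mem_ofPred_eq, map_smul]
    exact TemperedDistribution.MemSobolev.smul c hψ

/-- For `ψ ∈ H²(ℝ^d)` the distribution `-Δ ψ` is in `L²`. -/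
theorem exists_laplacian {d : ℕ} (ψ : sobolevTwo d) :
    ∃ φ : L2 d, toDist d φ = -Δ (toDist d ψ) := by
  have h := TemperedDistribution.MemSobolev.laplacian ψ.2
  rw [sub_self] at h
  obtain ⟨φ, hφ⟩ := TemperedDistribution.memSobolev_zero_iff.mp h
  exact ⟨-φ, by rw [map_neg, hφ]; rfl⟩

/-- The free Hamiltonian `H₀ = -Δ` on `L²(ℝ^d)`, with domain the Sobolev space `H²(ℝ^d)`;
`Δ` is the distributional Laplacian. -/
def freeHamiltonian (d : ℕ) : L2 d →ₗ.[ℂ] L2 d where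
  domain := sobolevTwo d
  toFun :=
    { toFun := fun ψ => (exists_laplacian ψ).choose
      map_add' := by
        intro ψ φ
        apply toDist_injective d
        rw [map_add, (exists_laplacian ψ).choose_spec, (exists_laplacian φ).choose_spec,
          (exists_laplacian (ψ + φ)).choose_spec, Submodule.coe_add, map_add,
          ← TemperedDistribution.laplacianCLM_apply, map_add, neg_add]
        simp only [TemperedDistribution.laplacianCLM_apply]
      map_smul' := by
        intro c ψ
        apply toDist_injective d
        rw [RingHom.id_apply, map_smul, (exists_laplacian ψ).choose_spec,
          (exists_laplacian (c • ψ)).choose_spec, Submodule.coe_smul, map_smul,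
          ← TemperedDistribution.laplacianCLM_apply, map_smul, smul_neg]
        simp only [TemperedDistribution.laplacianCLM_apply] }

/-- The `j`-th momentum operator `Ξ_j = -i [Q_j, H₀]` on `L²(ℝ^d)` with its maximal domain. -/
def momentum (d : ℕ) (j : Fin d) : L2 d →ₗ.[ℂ] L2 d :=
  maxCommutator (position d j) (freeHamiltonian d)

/-! ## The lattice: `ℓ²(ℤ^d)` -/

/-- The Hilbert space `ℓ²(ℤ^d)`. -/
abbrev l2 (d : ℕ) : Type := lp (fun _ : Fin d → ℤ => ℂ) 2

/-- The domain `{ψ : n_j ψ ∈ ℓ²}` of the `j`-th position operator on `ℓ²(ℤ^d)`. -/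
def latticePositionDomain (d : ℕ) (j : Fin d) : Submodule ℂ (l2 d) where
  carrier := {ψ | Memℓp (fun n : Fin d → ℤ => ((n j : ℤ) : ℂ) * ψ n) 2}
  zero_mem' := by
    have h : (fun n : Fin d → ℤ => ((n j : ℤ) : ℂ) * (0 : l2 d) n) = 0 := by ext; simp
    rw [Set.mem_ofPred_eq, h]; exact zero_memℓp
  add_mem' := by
    intro ψ φ hψ hφ
    have h := Memℓp.add hψ hφ
    refine (congrArg (fun f => Memℓp f 2) ?_).mp h
    ext n; simp [mul_add]
  smul_mem' := by
    intro c ψ hψ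
    have h := Memℓp.const_smul hψ c
    refine (congrArg (fun f => Memℓp f 2) ?_).mp h
    ext n; simp [mul_left_comm]

/-- The `j`-th position operator: multiplication by the coordinate `n_j` on `ℓ²(ℤ^d)`. -/
def latticePosition (d : ℕ) (j : Fin d) : l2 d →ₗ.[ℂ] l2 d where
  domain := latticePositionDomain d j
  toFun :=
    { toFun := fun ψ => ⟨fun n => ((n j : ℤ) : ℂ) * (ψ : l2 d) n, ψ.2⟩
      map_add' := by
        intro ψ φ; ext n
        exact mul_add _ ((ψ : l2 d) n) ((φ : l2 d) n)
      map_smul' := by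
        intro c ψ; ext n
        exact mul_left_comm _ c ((ψ : l2 d) n) }

/-- The translation `(T_a ψ)(n) = ψ(n + a)` on `ℓ²(ℤ^d)`. -/
def translation (d : ℕ) (a : Fin d → ℤ) : l2 d →ₗ[ℂ] l2 d where
  toFun ψ := ⟨fun n => ψ (n + a), by
    have h : Memℓp (ψ : (Fin d → ℤ) → ℂ) 2 := ψ.2
    have h2 : (0 : ℝ) < (2 : ENNReal).toReal := by norm_num
    rw [memℓp_gen_iff h2] at h
    exact (memℓp_gen_iff h2).mpr (h.comp_injective (add_left_injective a))⟩
  map_add' ψ φ := by ext n; rfl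
  map_smul' c ψ := by ext n; rfl

/-- The sum over nearest neighbours, `ψ ↦ (n ↦ ∑_{|m - n|₁ = 1} ψ(m))`, on `ℓ²(ℤ^d)`. -/
def neighborSum (d : ℕ) : l2 d →ₗ[ℂ] l2 d :=
  ∑ k : Fin d, (translation d (Pi.single k 1) + translation d (-Pi.single k 1))

/-- The free Hamiltonian `H₀ = -Δ`, `(-Δ ψ)(n) = ∑_{|m - n|₁ = 1} (ψ(n) - ψ(m))`, defined on
all of `ℓ²(ℤ^d)`. -/
def latticeHamiltonian (d : ℕ) : l2 d →ₗ.[ℂ] l2 d :=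
  ((2 * d : ℂ) • LinearMap.id - neighborSum d).toPMap ⊤

/-- The free Hamiltonian in the other common normalization, without the diagonal term:
`(H₀ ψ)(n) = ∑_{|m - n|₁ = 1} ψ(m)`, with symbol `∑_k 2 cos ξ_k`. -/
def latticeHopping (d : ℕ) : l2 d →ₗ.[ℂ] l2 d := (neighborSum d).toPMap ⊤

/-- The `j`-th momentum operator `Ξ_j = -i [Q_j, H]` on `ℓ²(ℤ^d)` with its maximal domain, for
the free Hamiltonian `H` in either normalization. -/
def latticeMomentum (d : ℕ) (H : l2 d →ₗ.[ℂ] l2 d) (j : Fin d) : l2 d →ₗ.[ℂ] l2 d :=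
  maxCommutator (latticePosition d j) H

end Ballistic

end

/-! Formally, `d/dt Q(t) = e^{itH₀} (-i[Q, H₀]) e^{-itH₀}`, and `Ξ = -i[Q, H₀]` is translation
invariant like `H₀`, so it commutes with the propagator. Hence `Q(t) = Q + tΞ`, and division by `t`
leaves `Ξ`. The substance of the proof is the control of domains.

The tool for this is `DualCore A C`: `A` is symmetric and equals the adjoint of its restriction to
`C`. An identity checked on `C` then extends by duality. `maxCommutator_eq` identifies `Ξ` in this
way, and `heisenberg_of_core` extends the Heisenberg relation to `D(Q) ∩ D(Ξ)`.

In the continuum `C` is the Schwartz space, which the Fourier transform and the propagator preserve.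
The commutator of `x_j` with the Fourier multiplier of symbol `g` has symbol `(i/2π) ∂_j g`
(`smulLeftCLM_coord_fourierMultiplierCLM`). For `g = (2π)²|ξ|²` this yields `Ξ_j`, with symbol
`4πξ_j`; for `g = e^{-it(2π)²|ξ|²}` it yields the Heisenberg relation. The closure statement holds
because Schwartz functions form a joint core of the `Q_j`.

On the lattice `H₀` and `Ξ` are bounded and commute. The exponential series is therefore pushed
through the closed operator `Q_j` term by term (`exp_mem_graph`), and using both `t` and `-t` gives
equality of domains.

Strong resolvent convergence follows from convergence on a core of the limit, together with the
uniform bound `|Im z|⁻¹` on the resolvents. A propagator is determined by its densely defined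
generator, so it suffices to treat explicit ones. -/

noncomputable section

namespace Ballistic

/-! ### Partial operators through their graphs -/

section Graph

variable {E : Type*} [NormedAddCommGroup E] [InnerProductSpace ℂ E]

local notation "⟪" x ", " y "⟫" => inner ℂ x y

/-- Working with pairs in a graph avoids carrying proofs of domain membership inside arguments;
operator identities below are mostly proved in this form. -/
theorem mem_graph_iff_exists {F : Type*} [AddCommGroup F] [Module ℂ F] {A : E →ₗ.[ℂ] F}
    {x : E} {y : F} : (x, y) ∈ A.graph ↔ ∃ h : x ∈ A.domain, A ⟨x, h⟩ = y := by
  simp [LinearPMap.mem_graph_iff]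

theorem mk_mem_graph {F : Type*} [AddCommGroup F] [Module ℂ F] {A : E →ₗ.[ℂ] F}
    {x : E} (h : x ∈ A.domain) : (x, A ⟨x, h⟩) ∈ A.graph :=
  mem_graph_iff_exists.mpr ⟨h, rfl⟩

theorem apply_eq_of_mem_graph {F : Type*} [AddCommGroup F] [Module ℂ F] {A : E →ₗ.[ℂ] F}
    {x : E} {y : F} (h : (x, y) ∈ A.graph) (hx : x ∈ A.domain) : A ⟨x, hx⟩ = y := by
  obtain ⟨_, h'⟩ := mem_graph_iff_exists.mp h
  exact h'

theorem eq_of_forall_mem_graph_iff {F : Type*} [AddCommGroup F] [Module ℂ F]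
    {A B : E →ₗ.[ℂ] F} (h : ∀ x y, (x, y) ∈ A.graph ↔ (x, y) ∈ B.graph) : A = B :=
  LinearPMap.eq_of_eq_graph (SetLike.ext fun ⟨x, y⟩ => h x y)

theorem le_of_forall_mem_graph {F : Type*} [AddCommGroup F] [Module ℂ F]
    {A B : E →ₗ.[ℂ] F} (h : ∀ x y, (x, y) ∈ A.graph → (x, y) ∈ B.graph) : A ≤ B :=
  LinearPMap.le_of_le_graph fun ⟨x, y⟩ => h x y

theorem mem_graph_smul {F : Type*} [AddCommGroup F] [Module ℂ F] {A : E →ₗ.[ℂ] F} {c : ℂ}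
    {x : E} {y : F} : (x, y) ∈ (c • A).graph ↔ ∃ y', (x, y') ∈ A.graph ∧ c • y' = y := by
  simp only [mem_graph_iff_exists]
  constructor
  · rintro ⟨h, rfl⟩
    exact ⟨_, ⟨h, rfl⟩, rfl⟩
  · rintro ⟨_, ⟨h, rfl⟩, rfl⟩
    exact ⟨h, rfl⟩

theorem mem_graph_add {F : Type*} [AddCommGroup F] [Module ℂ F] {A B : E →ₗ.[ℂ] F}
    {x : E} {y : F} : (x, y) ∈ (A + B).graph ↔
      ∃ a b, (x, a) ∈ A.graph ∧ (x, b) ∈ B.graph ∧ a + b = y := by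
  simp only [mem_graph_iff_exists]
  constructor
  · rintro ⟨h, rfl⟩
    exact ⟨_, _, ⟨h.1, rfl⟩, ⟨h.2, rfl⟩, rfl⟩
  · rintro ⟨_, _, ⟨h, rfl⟩, ⟨h', rfl⟩, rfl⟩
    exact ⟨⟨h, h'⟩, rfl⟩

theorem mem_graph_toPMap_top {f : E →ₗ[ℂ] E} {x y : E} :
    (x, y) ∈ (f.toPMap ⊤).graph ↔ f x = y := by
  simp only [mem_graph_iff_exists]
  exact ⟨fun ⟨_, h⟩ => h, fun h => ⟨trivial, h⟩⟩

theorem mem_graph_commutator {A B : E →ₗ.[ℂ] E} {x y : E} :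
    (x, y) ∈ (commutator A B).graph ↔ ∃ b ab a ba, (x, b) ∈ B.graph ∧ (b, ab) ∈ A.graph ∧
      (x, a) ∈ A.graph ∧ (a, ba) ∈ B.graph ∧ ab - ba = y := by
  simp only [mem_graph_iff_exists]
  constructor
  · rintro ⟨⟨⟨h1, h2⟩, ⟨h3, h4⟩⟩, rfl⟩
    exact ⟨_, _, _, _, ⟨h1, rfl⟩, ⟨h2, rfl⟩, ⟨h3, rfl⟩, ⟨h4, rfl⟩, rfl⟩
  · rintro ⟨_, _, _, _, ⟨h1, rfl⟩, ⟨h2, rfl⟩, ⟨h3, rfl⟩, ⟨h4, rfl⟩, rfl⟩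
    exact ⟨⟨⟨h1, h2⟩, ⟨h3, h4⟩⟩, rfl⟩

theorem mem_graph_vec {d : ℕ} {A : Fin d → E →ₗ.[ℂ] E} {x : E}
    {y : PiLp 2 (fun _ : Fin d => E)} :
    (x, y) ∈ (vec A).graph ↔ ∀ j, (x, y j) ∈ (A j).graph := by
  simp only [mem_graph_iff_exists]
  constructor
  · rintro ⟨h, rfl⟩ j
    exact ⟨(Submodule.mem_iInf _).mp h j, rfl⟩
  · intro h
    refine ⟨(Submodule.mem_iInf _).mpr fun j => (h j).1, ?_⟩
    ext j
    exact (h j).2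

theorem mem_vec_domain {d : ℕ} {A : Fin d → E →ₗ.[ℂ] E} {x : E} :
    x ∈ (vec A).domain ↔ ∀ j, x ∈ (A j).domain :=
  Submodule.mem_iInf _

theorem vec_isClosed {d : ℕ} {A : Fin d → E →ₗ.[ℂ] E} (h : ∀ j, (A j).IsClosed) :
    (vec A).IsClosed := by
  have : ((vec A).graph : Set (E × PiLp 2 (fun _ : Fin d => E))) =
      ⋂ j, (fun p : E × PiLp 2 (fun _ : Fin d => E) => (p.1, p.2 j)) ⁻¹' ((A j).graph) := by
    ext ⟨x, y⟩
    simp only [SetLike.mem_coe, mem_graph_vec, Set.mem_iInter, Set.mem_preimage]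
  rw [LinearPMap.IsClosed, this]
  refine isClosed_iInter fun j => (h j).preimage ?_
  fun_prop

/-- `V⁻¹ A V` for a unitary `V`, on its natural domain. -/
def conjOp (V : E ≃ₗᵢ[ℂ] E) (A : E →ₗ.[ℂ] E) : E →ₗ.[ℂ] E where
  domain := A.domain.comap (V.toLinearEquiv : E →ₗ[ℂ] E)
  toFun := (V.symm.toLinearEquiv : E →ₗ[ℂ] E) ∘ₗ A.toFun ∘ₗ
    (V.toLinearEquiv : E →ₗ[ℂ] E).restrict (fun _ hx => hx)

theorem mem_graph_conjOp {V : E ≃ₗᵢ[ℂ] E} {A : E →ₗ.[ℂ] E} {x y : E} :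
    (x, y) ∈ (conjOp V A).graph ↔ (V x, V y) ∈ A.graph := by
  simp only [mem_graph_iff_exists]
  constructor
  · rintro ⟨h, rfl⟩
    exact ⟨h, (V.apply_symm_apply _).symm⟩
  · rintro ⟨h, h'⟩
    exact ⟨h, (congrArg V.symm h').trans (V.symm_apply_apply y)⟩

/-- A closed extension `R` makes `T` closable, so the graph of `T.closure` is the topological
closure of the graph of `T`; only the density of one graph in the other is left to check. -/
theorem closure_eq_of_graph_subset {F : Type*} [NormedAddCommGroup F] [InnerProductSpace ℂ F]
    {T R : E →ₗ.[ℂ] F} (hR : R.IsClosed) (h : T ≤ R)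
    (hd : ∀ x y, (x, y) ∈ R.graph → (x, y) ∈ _root_.closure (T.graph : Set (E × F))) :
    T.closure = R := by
  have hT : T.IsClosable := hR.isClosable.leIsClosable h
  apply LinearPMap.eq_of_eq_graph
  rw [← hT.graph_closure_eq_closure_graph]
  apply le_antisymm
  · exact Submodule.topologicalClosure_minimal _ (LinearPMap.le_graph_of_le h) hR
  · rintro ⟨x, y⟩ hxy
    exact hd x y hxy

end Graph

/-! ### Duality cores, maximal commutators, extension of the Heisenberg relation -/

section Core

variable {E : Type*} [NormedAddCommGroup E] [InnerProductSpace ℂ E]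

local notation "⟪" x ", " y "⟫" => inner ℂ x y

/-- `A` is symmetric on its domain and equal to the adjoint of its restriction to the dense
subspace `C`. -/
structure DualCore (A : E →ₗ.[ℂ] E) (C : Submodule ℂ E) : Prop where
  dense : Dense (C : Set E)
  le : C ≤ A.domain
  symm : ∀ {x x' y y'}, (x, x') ∈ A.graph → (y, y') ∈ A.graph → ⟪x', y⟫ = ⟪x, y'⟫
  dual : ∀ {ψ φ}, (∀ χ ∈ C, ∀ χ', (χ, χ') ∈ A.graph → ⟪φ, χ⟫ = ⟪ψ, χ'⟫) → (ψ, φ) ∈ A.graph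

theorem mem_graph_adjoint [CompleteSpace E] {A : E →ₗ.[ℂ] E} (hA : Dense (A.domain : Set E))
    {y w : E} : (y, w) ∈ A†.graph ↔ ∀ x x', (x, x') ∈ A.graph → ⟪w, x⟫ = ⟪y, x'⟫ := by
  constructor
  · rintro h x x' hx
    obtain ⟨hy, rfl⟩ := mem_graph_iff_exists.mp h
    obtain ⟨hx', rfl⟩ := mem_graph_iff_exists.mp hx
    exact LinearPMap.adjoint_isFormalAdjoint hA ⟨y, hy⟩ ⟨x, hx'⟩
  · intro h
    have h' : ∀ x : A.domain, ⟪w, (x : E)⟫ = ⟪y, A x⟫ := fun x => h _ _ (mk_mem_graph x.2)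
    exact mem_graph_iff_exists.mpr ⟨LinearPMap.mem_adjoint_domain_of_exists y ⟨w, h'⟩,
      LinearPMap.adjoint_apply_eq hA _ h'⟩

namespace DualCore

variable {A : E →ₗ.[ℂ] E} {C : Submodule ℂ E}

theorem dense_domain (h : DualCore A C) : Dense (A.domain : Set E) := h.dense.mono h.le

/-- Symmetry gives `A ≤ A†`. An element of the graph of `A†` passes in particular the tests against
`C`, so `dual` gives `A† ≤ A`. -/
theorem isSelfAdjoint [CompleteSpace E] (h : DualCore A C) : IsSelfAdjoint A := by
  rw [LinearPMap.isSelfAdjoint_def]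
  refine eq_of_forall_mem_graph_iff fun x y => ?_
  rw [mem_graph_adjoint h.dense_domain]
  exact ⟨fun H => h.dual fun χ _ χ' hχ => H χ χ' hχ, fun H _ _ H' => h.symm H H'⟩

theorem of_isSelfAdjoint [CompleteSpace E] (h : IsSelfAdjoint A) : DualCore A A.domain := by
  have h' : ∀ {y w}, (y, w) ∈ A.graph ↔ ∀ x x', (x, x') ∈ A.graph → ⟪w, x⟫ = ⟪y, x'⟫ := by
    intro y w
    rw [← mem_graph_adjoint h.dense_domain, LinearPMap.isSelfAdjoint_def.mp h]
  exact
    { dense := h.dense_domain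
      le := le_rfl
      symm := fun hx hy => h'.mp hx _ _ hy
      dual := fun H => h'.mpr fun x x' hx =>
        H x (LinearPMap.mem_domain_iff.mpr ⟨x', hx⟩) x' hx }

/-- The value `c = 0` has to be excluded: `0 • A` keeps the domain of `A`, whereas `dual` would
force it to be everything. -/
theorem smul (h : DualCore A C) {c : ℝ} (hc : c ≠ 0) : DualCore ((c : ℂ) • A) C where
  dense := h.dense
  le := h.le
  symm := by
    intro x x' y y' hx hy
    obtain ⟨x', h1, rfl⟩ := mem_graph_smul.mp hx
    obtain ⟨y', h2, rfl⟩ := mem_graph_smul.mp hy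
    simp [h.symm h1 h2]
  dual := by
    intro ψ φ H
    have hc' : (c : ℂ) ≠ 0 := by exact_mod_cast hc
    refine mem_graph_smul.mpr ⟨(c : ℂ)⁻¹ • φ, h.dual fun χ hχ χ' hχ' => ?_, by
      rw [smul_smul, mul_inv_cancel₀ hc', one_smul]⟩
    have := H χ hχ _ (mem_graph_smul.mpr ⟨χ', hχ', rfl⟩)
    rw [inner_smul_left, this, inner_smul_right]
    simp [hc']

theorem conjOp (h : DualCore A C) (V : E ≃ₗᵢ[ℂ] E) :
    DualCore (conjOp V A) (C.comap (V.toLinearEquiv : E →ₗ[ℂ] E)) where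
  dense := by
    have := h.dense.preimage V.toHomeomorph.isOpenMap
    exact this
  le := fun x hx => h.le hx
  symm := by
    intro x x' y y' hx hy
    rw [mem_graph_conjOp] at hx hy
    rw [← V.inner_map_map, h.symm hx hy, V.inner_map_map]
  dual := by
    intro ψ φ H
    rw [mem_graph_conjOp]
    refine h.dual fun χ hχ χ' hχ' => ?_
    have := H (V.symm χ) (by simpa using hχ) (V.symm χ') (mem_graph_conjOp.mpr (by simpa using hχ'))
    rw [← V.inner_map_map, ← V.inner_map_map ψ] at this
    simpa using this

theorem toPMap_top {f : E →ₗ[ℂ] E} (hf : f.IsSymmetric) (hC : Dense (C : Set E)) :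
    DualCore (f.toPMap ⊤) C where
  dense := hC
  le := fun _ _ => trivial
  symm := by
    intro x x' y y' hx hy
    rw [mem_graph_toPMap_top] at hx hy
    rw [← hx, ← hy, hf]
  dual := by
    intro ψ φ H
    rw [mem_graph_toPMap_top]
    refine (hC.eq_of_inner_left ℂ fun χ hχ => ?_)
    rw [hf]
    exact (H χ hχ _ (mem_graph_toPMap_top.mpr rfl)).symm

end DualCore

/-- If a symmetric extension agrees with `-i [Q, H]` on a core, then it is the maximal
commutator. -/
theorem maxCommutator_eq [CompleteSpace E] {Q H M : E →ₗ.[ℂ] E} {C : Submodule ℂ E}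
    (hM : DualCore M C)
    (hQ : ∀ {x x' y y'}, (x, x') ∈ Q.graph → (y, y') ∈ Q.graph → ⟪x', y⟫ = ⟪x, y'⟫)
    (hH : ∀ {x x' y y'}, (x, x') ∈ H.graph → (y, y') ∈ H.graph → ⟪x', y⟫ = ⟪x, y'⟫)
    (hC : ∀ χ ∈ C, ∃ χ', (χ, χ') ∈ M.graph ∧ (χ, Complex.I • χ') ∈ (commutator Q H).graph) :
    maxCommutator Q H = M := by
  set K := (-Complex.I) • commutator Q H with hK
  have hKM : ∀ χ ∈ C, ∃ χ', (χ, χ') ∈ M.graph ∧ (χ, χ') ∈ K.graph := by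
    intro χ hχ
    obtain ⟨χ', h1, h2⟩ := hC χ hχ
    refine ⟨χ', h1, mem_graph_smul.mpr ⟨_, h2, ?_⟩⟩
    simp [smul_smul]
  have hKsymm : ∀ {x x' y y'}, (x, x') ∈ K.graph → (y, y') ∈ K.graph → ⟪x', y⟫ = ⟪x, y'⟫ := by
    intro x x' y y' hx hy
    obtain ⟨_, hx0, rfl⟩ := mem_graph_smul.mp hx
    obtain ⟨_, hy0, rfl⟩ := mem_graph_smul.mp hy
    obtain ⟨hx1, hx2, hx3, hx4, h1, h2, h3, h4, rfl⟩ := mem_graph_commutator.mp hx0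
    obtain ⟨hy1, hy2, hy3, hy4, k1, k2, k3, k4, rfl⟩ := mem_graph_commutator.mp hy0
    -- `QH` and `HQ` are formal adjoints of each other, so `[Q, H]` is formally antisymmetric and
    -- the factor `-i` makes it symmetric.
    have e1 : ⟪hx2, y⟫ = ⟪x, hy4⟫ := by rw [hQ h2 k3, hH h1 k4]
    have e2 : ⟪hx4, y⟫ = ⟪x, hy2⟫ := by rw [hH h4 k1, hQ h3 k2]
    simp only [inner_smul_left, inner_smul_right, inner_sub_left, inner_sub_right, e1, e2]
    simp
    ring
  have hdom : Dense (K.domain : Set E) := by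
    refine hM.dense.mono fun χ hχ => ?_
    obtain ⟨χ', _, h⟩ := hKM χ hχ
    exact LinearPMap.mem_domain_iff.mpr ⟨_, h⟩
  have hCK : ∀ χ ∈ C, ∀ χ', (χ, χ') ∈ M.graph → (χ, χ') ∈ K.graph := by
    intro χ hχ χ' h
    obtain ⟨χ'', h1, h2⟩ := hKM χ hχ
    rwa [LinearPMap.mem_graph_snd_inj M h h1 rfl]
  -- `K` is symmetric and extends `M` restricted to `C`, so it lies below the adjoint of that
  -- restriction, which is `M`. Then `K† ≤ M` by duality again, and `M ≤ K†` because `M` is a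
  -- symmetric extension of `K`.
  have hle : ∀ x x', (x, x') ∈ K.graph → (x, x') ∈ M.graph := fun x x' hx =>
    hM.dual fun χ hχ χ' hχ' => hKsymm hx (hCK χ hχ χ' hχ')
  refine eq_of_forall_mem_graph_iff fun x y => ?_
  rw [maxCommutator, mem_graph_adjoint hdom]
  exact ⟨fun h => hM.dual fun χ hχ χ' hχ' => h χ χ' (hCK χ hχ χ' hχ'),
    fun h z z' hz => hM.symm h (hle z z' hz)⟩

/-- The Heisenberg relation extends by duality from an invariant core. -/
theorem heisenberg_of_core {Q M : E →ₗ.[ℂ] E} {C : Submodule ℂ E} (hQ : DualCore Q C)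
    (hM : ∀ {x x' y y'}, (x, x') ∈ M.graph → (y, y') ∈ M.graph → ⟪x', y⟫ = ⟪x, y'⟫)
    (V : E ≃ₗᵢ[ℂ] E) (t : ℝ) (hV : ∀ χ ∈ C, V.symm χ ∈ C)
    (hC : ∀ χ ∈ C, ∃ q m, (χ, q) ∈ Q.graph ∧ (χ, m) ∈ M.graph ∧
      (V χ, V (q + (t : ℂ) • m)) ∈ Q.graph)
    {ψ q m : E} (hq : (ψ, q) ∈ Q.graph) (hm : (ψ, m) ∈ M.graph) :
    (V ψ, V (q + (t : ℂ) • m)) ∈ Q.graph := by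
  -- Test against `χ ∈ C`. Since `V⁻¹χ` is again in `C`, the relation known on the core computes
  -- `Qχ`, and symmetry of `Q` and `M` moves everything onto `ψ`.
  refine hQ.dual fun χ hχ χ' hχ' => ?_
  obtain ⟨q', m', h1, h2, h3⟩ := hC _ (hV χ hχ)
  rw [V.apply_symm_apply] at h3
  rw [LinearPMap.mem_graph_snd_inj Q hχ' h3 rfl, V.inner_map_map, ← V.apply_symm_apply χ,
    V.inner_map_map, inner_add_left, inner_add_right, inner_smul_left, inner_smul_right,
    hQ.symm hq h1, hM hm h2]
  simp

end Core

/-! ### Resolvents of self-adjoint operators and strong resolvent convergence -/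

section Resolvent

variable {E : Type*} [NormedAddCommGroup E] [InnerProductSpace ℂ E]

local notation "⟪" x ", " y "⟫" => inner ℂ x y

/-- `‖(A - z) x‖ ≥ |Im z| ‖x‖` for symmetric `A`. -/
theorem DualCore.abs_im_mul_norm_le {A : E →ₗ.[ℂ] E} {C : Submodule ℂ E} (h : DualCore A C)
    (z : ℂ) {x y : E} (hx : (x, y) ∈ A.graph) : |z.im| * ‖x‖ ≤ ‖y - z • x‖ := by
  have h1 : (⟪x, y⟫).im = 0 := by
    have : (starRingEnd ℂ) ⟪x, y⟫ = ⟪x, y⟫ := by rw [inner_conj_symm, h.symm hx hx]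
    exact Complex.conj_eq_iff_im.mp this
  -- As `⟪x, Ax⟫` is real, the imaginary part sees only `z`; Cauchy–Schwarz then gives the bound.
  have h2 : (⟪x, y - z • x⟫).im = -(z.im * ‖x‖ ^ 2) := by
    rw [inner_sub_right, inner_smul_right, inner_self_eq_norm_sq_to_K, Complex.sub_im, h1]
    simp [← Complex.ofReal_pow]
  have h3 : |z.im| * ‖x‖ ^ 2 ≤ ‖x‖ * ‖y - z • x‖ := by
    calc |z.im| * ‖x‖ ^ 2 = |(⟪x, y - z • x⟫).im| := by
          rw [h2, abs_neg, abs_mul, abs_of_nonneg (sq_nonneg ‖x‖)]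
      _ ≤ ‖⟪x, y - z • x⟫‖ := Complex.abs_im_le_norm _
      _ ≤ _ := norm_inner_le_norm _ _
  rcases (norm_nonneg x).eq_or_lt with h0 | h0
  · rw [← h0]; simp
  · nlinarith

/-- A vector `φ` orthogonal to `(A - z)C` satisfies, by duality, `φ ∈ D(A)` and `Aφ = z̄φ`; a
symmetric operator has no nonreal eigenvalue, so `φ = 0`. -/
theorem DualCore.dense_image_sub {A : E →ₗ.[ℂ] E} [CompleteSpace E] {C : Submodule ℂ E}
    (h : DualCore A C) {z : ℂ} (hz : z.im ≠ 0) :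
    Dense {w : E | ∃ x ∈ C, ∃ y, (x, y) ∈ A.graph ∧ y - z • x = w} := by
  let S : Submodule ℂ E :=
    { carrier := {w : E | ∃ x ∈ C, ∃ y, (x, y) ∈ A.graph ∧ y - z • x = w}
      zero_mem' := ⟨0, C.zero_mem, 0, A.graph.zero_mem, by simp⟩
      add_mem' := by
        rintro _ _ ⟨x, hx, y, hxy, rfl⟩ ⟨x', hx', y', hxy', rfl⟩
        exact ⟨x + x', C.add_mem hx hx', y + y', A.graph.add_mem hxy hxy', by
          rw [smul_add]; abel⟩
      smul_mem' := by
        rintro c _ ⟨x, hx, y, hxy, rfl⟩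
        exact ⟨c • x, C.smul_mem c hx, c • y, A.graph.smul_mem c hxy, by
          rw [smul_sub, smul_comm]⟩ }
  change Dense (S : Set E)
  rw [Submodule.dense_iff_topologicalClosure_eq_top, Submodule.topologicalClosure_eq_top_iff,
    Submodule.eq_bot_iff]
  intro φ hφ
  rw [Submodule.mem_orthogonal'] at hφ
  have hg : (φ, (starRingEnd ℂ) z • φ) ∈ A.graph := h.dual fun χ hχ χ' hχ' => by
    have := hφ (χ' - z • χ) ⟨χ, hχ, χ', hχ', rfl⟩
    rw [inner_sub_right, sub_eq_zero, inner_smul_right] at this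
    rw [this, inner_smul_left, Complex.conj_conj]
  have := h.abs_im_mul_norm_le ((starRingEnd ℂ) z) hg
  rw [sub_self, norm_zero, Complex.conj_im, abs_neg] at this
  have hpos : 0 < |z.im| := abs_pos.mpr hz
  have : ‖φ‖ ≤ 0 := by nlinarith [norm_nonneg φ]
  exact norm_le_zero_iff.mp this

/-- The lower bound on `A - z` gives injectivity and, since `A` is closed, a closed range; the range
is also dense, hence everything. The same bound controls the inverse. -/
theorem exists_resolvent [CompleteSpace E] {A : E →ₗ.[ℂ] E} (hA : IsSelfAdjoint A) {z : ℂ}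
    (hz : z.im ≠ 0) : ∃ R : E →L[ℂ] E, IsResolvent A z R ∧ ∀ φ, ‖R φ‖ ≤ |z.im|⁻¹ * ‖φ‖ := by
  have h := DualCore.of_isSelfAdjoint hA
  have hpos : 0 < |z.im| := abs_pos.mpr hz
  let T : A.domain →ₗ[ℂ] E := A.toFun - z • A.domain.subtype
  have hT : ∀ x : A.domain, T x = A x - z • (x : E) := fun x => rfl
  have hbound : ∀ x : A.domain, |z.im| * ‖x‖ ≤ ‖T x‖ := fun x =>
    h.abs_im_mul_norm_le z (mk_mem_graph x.2)
  have hinj : Function.Injective T := by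
    rw [← LinearMap.ker_eq_bot, LinearMap.ker_eq_bot']
    intro x hx
    have := hbound x
    rw [hx, norm_zero] at this
    exact norm_le_zero_iff.mp (by nlinarith [norm_nonneg x])
  have hsurj : Function.Surjective T := by
    intro φ
    obtain ⟨u, hu, hlim⟩ := mem_closure_iff_seq_limit.mp (h.dense_image_sub hz φ)
    choose x hx y hxy hu using hu
    have hux : ∀ n, |z.im| * ‖x n‖ ≤ ‖u n‖ := fun n => hu n ▸ h.abs_im_mul_norm_le z (hxy n)
    have hc : CauchySeq x := by
      have hcu := hlim.cauchySeq
      rw [Metric.cauchySeq_iff] at hcu ⊢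
      intro ε hε
      obtain ⟨N, hN⟩ := hcu (|z.im| * ε) (by positivity)
      refine ⟨N, fun m hm n hn => ?_⟩
      have h1 := hN m hm n hn
      have h2 := h.abs_im_mul_norm_le z (A.graph.sub_mem (hxy m) (hxy n))
      have h3 : (y m - y n) - z • (x m - x n) = u m - u n := by
        rw [← hu m, ← hu n, smul_sub]; abel
      rw [h3, ← dist_eq_norm, ← dist_eq_norm] at h2
      exact lt_of_mul_lt_mul_left (h2.trans_lt h1) hpos.le
    obtain ⟨x0, hx0⟩ := cauchySeq_tendsto_of_complete hc
    have hy : Tendsto y atTop (𝓝 (φ + z • x0)) := by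
      have := hlim.add (hx0.const_smul z)
      refine this.congr fun n => ?_
      rw [← hu n]; abel
    have hmem : (x0, φ + z • x0) ∈ A.graph :=
      hA.isClosed.mem_of_tendsto (hx0.prodMk_nhds hy) (Eventually.of_forall hxy)
    obtain ⟨hd, he⟩ := mem_graph_iff_exists.mp hmem
    exact ⟨⟨x0, hd⟩, by rw [hT, he]; simp⟩
  let e := LinearEquiv.ofBijective T ⟨hinj, hsurj⟩
  have he : ∀ x, e x = T x := fun x => rfl
  have hnorm : ∀ φ, ‖(A.domain.subtype ∘ₗ e.symm.toLinearMap) φ‖ ≤ |z.im|⁻¹ * ‖φ‖ := by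
    intro φ
    have := hbound (e.symm φ)
    rw [← he, e.apply_symm_apply] at this
    rw [inv_mul_eq_div, le_div_iff₀ hpos, mul_comm]
    exact this
  refine ⟨LinearMap.mkContinuous (A.domain.subtype ∘ₗ e.symm.toLinearMap) _ hnorm,
    ⟨fun φ => ⟨(e.symm φ).2, ?_⟩, fun ψ => ?_⟩, fun φ => hnorm φ⟩
  · exact e.apply_symm_apply φ
  · change ((e.symm (e ψ) : A.domain) : E) = ψ
    rw [e.symm_apply_apply]

/-- Convergence on a common core implies strong resolvent convergence. -/
theorem strongResolventTendsto_of_core [CompleteSpace E] {ι : Type*} {A : ι → E →ₗ.[ℂ] E}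
    {l : Filter ι} {B : E →ₗ.[ℂ] E} {C : Submodule ℂ E} (hA : ∀ᶠ t in l, IsSelfAdjoint (A t))
    (hB : DualCore B C)
    (hC : ∀ χ ∈ C, ∀ b, (χ, b) ∈ B.graph → ∃ a : ι → E, (∀ᶠ t in l, (χ, a t) ∈ (A t).graph) ∧
      Tendsto a l (𝓝 b)) :
    StrongResolventTendsto A l B := by
  classical
  refine ⟨hA, hB.isSelfAdjoint, fun z hz => ?_⟩
  obtain ⟨R', hR', hn'⟩ := exists_resolvent hB.isSelfAdjoint hz
  have hpos : 0 < |z.im| := abs_pos.mpr hz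
  have hex : ∀ t, ∃ R : E →L[ℂ] E, (IsSelfAdjoint (A t) → IsResolvent (A t) z R) ∧
      ∀ φ, ‖R φ‖ ≤ |z.im|⁻¹ * ‖φ‖ := by
    intro t
    by_cases ht : IsSelfAdjoint (A t)
    · obtain ⟨R, h1, h2⟩ := exists_resolvent ht hz
      exact ⟨R, fun _ => h1, h2⟩
    -- Where `A t` is not self-adjoint, the filler `0` keeps the norm bound valid for every `t`.
    · exact ⟨0, fun h => absurd h ht, fun φ => by simpa using by positivity⟩
  choose R hR hn using hex
  refine ⟨R, R', hA.mono fun t ht => hR t ht, hR', fun φ => ?_⟩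
  have hcore : ∀ w ∈ {w : E | ∃ x ∈ C, ∃ y, (x, y) ∈ B.graph ∧ y - z • x = w},
      Tendsto (fun t => R t w) l (𝓝 (R' w)) := by
    rintro w ⟨x, hx, y, hxy, rfl⟩
    obtain ⟨a, ha, hlim⟩ := hC x hx y hxy
    have hw : R' (y - z • x) = x := by
      obtain ⟨hd, rfl⟩ := mem_graph_iff_exists.mp hxy
      exact hR'.2 ⟨x, hd⟩
    rw [hw, tendsto_iff_norm_sub_tendsto_zero]
    have hlim' : Tendsto (fun t => |z.im|⁻¹ * ‖y - a t‖) l (𝓝 0) := by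
      have := (tendsto_iff_norm_sub_tendsto_zero.mp hlim).const_mul |z.im|⁻¹
      rw [mul_zero] at this
      exact this.congr fun t => by rw [norm_sub_rev]
    refine tendsto_of_tendsto_of_tendsto_of_le_of_le' tendsto_const_nhds hlim'
      (Eventually.of_forall fun t => norm_nonneg _) ?_
    filter_upwards [hA, ha] with t ht hat
    obtain ⟨hd, hat⟩ := mem_graph_iff_exists.mp hat
    have : R t (a t - z • x) = x := by rw [← hat]; exact (hR t ht).2 ⟨x, hd⟩
    -- Resolvent identity on the core: with `a t = A_t x` and `y = Bx`, `R_t (B - z)x - x = R_t (B -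
    -- A_t)x`.
    calc ‖R t (y - z • x) - x‖ = ‖R t (y - a t)‖ := by
          conv_lhs => rw [← this]
          rw [← map_sub, this]
          congr 2
          abel
      _ ≤ _ := hn t _
  rw [Metric.tendsto_nhds]
  intro ε hε
  -- The radius `|Im z| ε / 3` is chosen so that each resolvent moves `φ` and `w` to within `ε / 3`
  -- of each other.
  obtain ⟨w, hw, hwd⟩ := (hB.dense_image_sub hz).exists_dist_lt φ
    (show 0 < |z.im| * ε / 3 by positivity)
  filter_upwards [Metric.tendsto_nhds.mp (hcore w hw) (ε / 3) (by positivity)] with t ht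
  have key : ∀ S : E →L[ℂ] E, (∀ φ, ‖S φ‖ ≤ |z.im|⁻¹ * ‖φ‖) → dist (S φ) (S w) < ε / 3 := by
    intro S hS
    rw [dist_eq_norm, ← map_sub]
    refine (hS _).trans_lt ?_
    rw [inv_mul_eq_div, div_lt_iff₀ hpos, ← dist_eq_norm]
    linarith
  have h1 := key (R t) (hn t)
  have h2 := key R' hn'
  rw [dist_comm] at h2
  calc dist (R t φ) (R' φ) ≤ dist (R t φ) (R t w) + dist (R t w) (R' w) + dist (R' w) (R' φ) :=
        dist_triangle4 _ _ _ _
    _ < ε := by linarith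

end Resolvent

/-! ### Consequences of the propagator axioms, uniqueness -/

section Propagator

variable {E : Type*} [NormedAddCommGroup E] [InnerProductSpace ℂ E]

local notation "⟪" x ", " y "⟫" => inner ℂ x y

namespace IsPropagator

variable {H : E →ₗ.[ℂ] E} {U V : ℝ → E →L[ℂ] E}

theorem apply_neg_apply (hU : IsPropagator H U) (t : ℝ) (ψ : E) : U t (U (-t) ψ) = ψ := by
  have := hU.add t (-t)
  rw [add_neg_cancel, hU.zero] at this
  exact (DFunLike.congr_fun this ψ).symm

theorem neg_apply_apply (hU : IsPropagator H U) (t : ℝ) (ψ : E) : U (-t) (U t ψ) = ψ := by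
  simpa using hU.apply_neg_apply (-t) ψ

/-- `e^{-itH}` as a unitary. -/
def unitary (hU : IsPropagator H U) (t : ℝ) : E ≃ₗᵢ[ℂ] E where
  toFun := U t
  invFun := U (-t)
  map_add' := (U t).map_add
  map_smul' := (U t).map_smul
  left_inv := hU.neg_apply_apply t
  right_inv := hU.apply_neg_apply t
  norm_map' := hU.isometry t

theorem heisenberg_eq (hU : IsPropagator H U) (A : E →ₗ.[ℂ] E) (t : ℝ) :
    heisenberg U A t = conjOp (hU.unitary t) A := rfl

theorem hasDerivAt_zero_iff (hU : IsPropagator H U) {ψ φ : E} :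
    HasDerivAt (fun t => U t ψ) φ 0 ↔ (ψ, Complex.I • φ) ∈ H.graph := by
  rw [hU.generator, mem_graph_iff_exists]
  refine exists_congr fun h => ?_
  constructor
  · rintro rfl; simp [smul_smul]
  · intro h'; rw [h']; simp [smul_smul]

theorem hasDerivAt (hU : IsPropagator H U) {ψ φ : E} (h : (ψ, φ) ∈ H.graph) (t : ℝ) :
    HasDerivAt (fun t => U t ψ) (U t ((-Complex.I) • φ)) t := by
  have h0 : HasDerivAt (fun t => U t ψ) ((-Complex.I) • φ) 0 :=
    hU.hasDerivAt_zero_iff.mpr (by simpa [smul_smul] using h)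
  have h1 : HasDerivAt (fun s => U (s - t) ψ) ((-Complex.I) • φ) t := by
    have := HasDerivAt.comp_sub_const (f := fun s => U s ψ) t t (by simpa using h0)
    simpa using this
  have h2 := ((U t).restrictScalars ℝ).hasFDerivAt.comp_hasDerivAt t h1
  refine h2.congr_of_eventuallyEq (Eventually.of_forall fun s => ?_)
  change U s ψ = U t (U (s - t) ψ)
  rw [← mul_apply_eq_comp, ← hU.add]
  simp

/-- By the group law the orbit of `U t ψ` is differentiable at `0`; since the generator is exactly
`-iH`, this puts `U t ψ` back in `D(H)`. -/
theorem apply_mem_graph (hU : IsPropagator H U) {ψ φ : E} (h : (ψ, φ) ∈ H.graph) (t : ℝ) :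
    (U t ψ, U t φ) ∈ H.graph := by
  have h1 : HasDerivAt (fun s => U s (U t ψ)) (U t ((-Complex.I) • φ)) 0 := by
    have := HasDerivAt.comp_add_const (f := fun s => U s ψ) 0 t (hU.hasDerivAt h (0 + t))
    simp only [zero_add] at this
    refine this.congr_of_eventuallyEq (Eventually.of_forall fun s => ?_)
    simp [hU.add]
  have := hU.hasDerivAt_zero_iff.mp h1
  rwa [map_smul, smul_smul, mul_neg, Complex.I_mul_I, neg_neg, one_smul] at this

/-- Differentiate the constant function `⟪U t x, U t y⟫` at `0`. -/
theorem inner_symm (hU : IsPropagator H U) {x x' y y' : E} (hx : (x, x') ∈ H.graph)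
    (hy : (y, y') ∈ H.graph) : ⟪x', y⟫ = ⟪x, y'⟫ := by
  have h := (hU.hasDerivAt hx 0).inner ℂ (hU.hasDerivAt hy 0)
  have hc : (fun t => ⟪U t x, U t y⟫) = fun _ => ⟪x, y⟫ := by
    ext t
    exact (hU.unitary t).inner_map_map x y
  rw [hc] at h
  have h0 := h.unique (hasDerivAt_const (0 : ℝ) ⟪x, y⟫)
  simp only [hU.zero, one_apply_eq_self, inner_smul_left, inner_smul_right] at h0
  simp only [map_neg, Complex.conj_I, neg_neg] at h0
  have h1 : Complex.I * (⟪x', y⟫ - ⟪x, y'⟫) = 0 := by linear_combination h0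
  rcases mul_eq_zero.mp h1 with h2 | h2
  · exact absurd h2 Complex.I_ne_zero
  · exact sub_eq_zero.mp h2

/-- For `x, y ∈ D(H)`, which both groups preserve, symmetry of `H` makes the derivative of `⟪U t x,
V t y⟫` vanish. Hence `V (-t) (U t x) = x` on a dense set. -/
theorem eq (hU : IsPropagator H U) (hV : IsPropagator H V) (hH : Dense (H.domain : Set E)) :
    U = V := by
  have key : ∀ {x x' y y'}, (x, x') ∈ H.graph → (y, y') ∈ H.graph → ∀ t,
      ⟪U t x, V t y⟫ = ⟪x, y⟫ := by
    intro x x' y y' hx hy t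
    have hd : ∀ s, HasDerivAt (fun t => ⟪U t x, V t y⟫) 0 s := by
      intro s
      have h := (hU.hasDerivAt hx s).inner ℂ (hV.hasDerivAt hy s)
      have e := hU.inner_symm (hU.apply_mem_graph hx s) (hV.apply_mem_graph hy s)
      have e' : ⟪U s x, V s ((-Complex.I) • y')⟫ + ⟪U s ((-Complex.I) • x'), V s y⟫ = 0 := by
        rw [map_smul, map_smul, inner_smul_left, inner_smul_right, e]
        simp
      rwa [e'] at h
    have := is_const_of_deriv_eq_zero (fun s => (hd s).differentiableAt) (fun s => (hd s).deriv) t 0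
    simpa [hU.zero, hV.zero] using this
  funext t
  refine ContinuousLinearMap.coeFn_injective
    ((U t).continuous.ext_on hH (V t).continuous fun x hx => ?_)
  obtain ⟨x', hx⟩ := LinearPMap.mem_domain_iff.mp hx
  have : V (-t) (U t x) = x := by
    refine hH.eq_of_inner_left ℂ fun y hy => ?_
    obtain ⟨y', hy⟩ := LinearPMap.mem_domain_iff.mp hy
    rw [← key hx hy t, ← (hV.unitary t).inner_map_map]
    congr 1
    exact hV.apply_neg_apply t _
  rw [← hV.apply_neg_apply t (U t x), this]

end IsPropagator

end Propagator

/-! ### Real multiplication operators on `L²(ℝ^d)` -/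

section Multiplication

variable {d : ℕ}

local notation "⟪" x ", " y "⟫" => inner ℂ x y
local notation "ℝ^" d => EuclideanSpace ℝ (Fin d)

/-- Multiplication by a real function on its maximal domain in `L²(ℝ^d)`. -/
def mulOp (g : (ℝ^d) → ℝ) : L2 d →ₗ.[ℂ] L2 d where
  domain :=
    { carrier := {ψ | MemLp (fun x => (g x : ℂ) * ψ x) 2 volume}
      zero_mem' := by
        refine MemLp.ae_eq (f := 0) ?_ MemLp.zero
        filter_upwards [Lp.coeFn_zero ℂ 2 (volume : Measure (ℝ^d))] with x hx
        simp only [hx, Pi.zero_apply, mul_zero]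
      add_mem' := by
        intro ψ φ hψ hφ
        refine MemLp.ae_eq ?_ (MemLp.add hψ hφ)
        filter_upwards [Lp.coeFn_add ψ φ] with x hx
        simp only [hx, Pi.add_apply, mul_add]
      smul_mem' := by
        intro c ψ hψ
        refine MemLp.ae_eq ?_ (MemLp.const_smul hψ c)
        filter_upwards [Lp.coeFn_smul c ψ] with x hx
        simp only [hx, Pi.smul_apply, smul_eq_mul, mul_left_comm] }
  toFun :=
    { toFun := fun ψ => MemLp.toLp (fun x => (g x : ℂ) * (ψ : L2 d) x) ψ.2
      map_add' := by
        intro ψ φ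
        refine Eq.trans ?_ (MemLp.toLp_add ψ.2 φ.2)
        apply MemLp.toLp_congr
        filter_upwards [Lp.coeFn_add (ψ : L2 d) (φ : L2 d)] with x hx
        simp only [Submodule.coe_add, hx, Pi.add_apply, mul_add]
      map_smul' := by
        intro c ψ
        refine Eq.trans ?_ (MemLp.toLp_const_smul c ψ.2)
        apply MemLp.toLp_congr
        filter_upwards [Lp.coeFn_smul c (ψ : L2 d)] with x hx
        simp only [Submodule.coe_smul, hx, Pi.smul_apply, smul_eq_mul, mul_left_comm] }

theorem position_eq_mulOp (j : Fin d) : position d j = mulOp fun x => x j := rfl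

theorem mem_mulOp_domain {g : (ℝ^d) → ℝ} {ψ : L2 d} :
    ψ ∈ (mulOp g).domain ↔ MemLp (fun x => (g x : ℂ) * ψ x) 2 volume := Iff.rfl

theorem mem_graph_mulOp {g : (ℝ^d) → ℝ} {ψ φ : L2 d} :
    (ψ, φ) ∈ (mulOp g).graph ↔ ∀ᵐ x, φ x = (g x : ℂ) * ψ x := by
  rw [mem_graph_iff_exists]
  constructor
  · rintro ⟨h, rfl⟩
    exact MemLp.coeFn_toLp h
  · intro h
    have h' : MemLp (fun x => (g x : ℂ) * ψ x) 2 volume := (Lp.memLp φ).ae_eq h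
    refine ⟨h', Lp.ext ?_⟩
    exact (MemLp.coeFn_toLp h').trans (h.mono fun x hx => hx.symm)

theorem smul_mulOp {g : (ℝ^d) → ℝ} {c : ℝ} (hc : c ≠ 0) :
    (c : ℂ) • mulOp g = mulOp fun x => c * g x := by
  have hc' : (c : ℂ) ≠ 0 := by exact_mod_cast hc
  refine eq_of_forall_mem_graph_iff fun ψ φ => ?_
  rw [mem_graph_smul, mem_graph_mulOp]
  constructor
  · rintro ⟨φ, h, rfl⟩
    filter_upwards [mem_graph_mulOp.mp h, Lp.coeFn_smul (c : ℂ) φ] with x h1 h2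
    rw [h2, Pi.smul_apply, h1, smul_eq_mul, Complex.ofReal_mul, mul_assoc]
  · intro h
    refine ⟨(c : ℂ)⁻¹ • φ, mem_graph_mulOp.mpr ?_, by rw [smul_smul, mul_inv_cancel₀ hc', one_smul]⟩
    filter_upwards [h, Lp.coeFn_smul (c : ℂ)⁻¹ φ] with x h1 h2
    rw [h2, Pi.smul_apply, h1, smul_eq_mul, Complex.ofReal_mul, mul_assoc, inv_mul_cancel_left₀ hc']

/-- The Schwartz functions as a subspace of `L²(ℝ^d)`. -/
def schwartzSubmodule (d : ℕ) : Submodule ℂ (L2 d) :=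
  LinearMap.range (SchwartzMap.toLpCLM ℂ (E := ℝ^d) ℂ 2 volume).toLinearMap

theorem dense_schwartzSubmodule (d : ℕ) : Dense (schwartzSubmodule d : Set (L2 d)) :=
  SchwartzMap.denseRange_toLpCLM ENNReal.ofNat_ne_top

theorem toLp_mem_graph_mulOp {g : (ℝ^d) → ℝ} (hg : g.HasTemperateGrowth) (f : 𝓢(ℝ^d, ℂ)) :
    (f.toLp 2 volume, (SchwartzMap.smulLeftCLM ℂ g f).toLp 2 volume) ∈ (mulOp g).graph := by
  rw [mem_graph_mulOp]
  filter_upwards [f.coeFn_toLp 2 volume, (SchwartzMap.smulLeftCLM ℂ g f).coeFn_toLp 2 volume]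
    with x h1 h2
  rw [h1, h2, SchwartzMap.smulLeftCLM_apply_apply hg, Complex.real_smul]

theorem locallyIntegrable_mul_L2 {g : (ℝ^d) → ℝ} (hg : Continuous g) (ψ : L2 d) :
    LocallyIntegrable (fun x => (g x : ℂ) * ψ x) volume := by
  have h : LocallyIntegrable ψ volume := (Lp.memLp ψ).locallyIntegrable (by norm_num)
  rw [← locallyIntegrableOn_univ] at h ⊢
  exact h.continuousOn_mul (Complex.continuous_ofReal.comp hg).continuousOn isOpen_univ.isLocallyClosed

/-- Temperate growth keeps Schwartz functions in the domain. For duality, smooth compactly supported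
real test functions already suffice to identify `φ` with `gψ` almost everywhere. -/
theorem dualCore_mulOp {g : (ℝ^d) → ℝ} (hg : g.HasTemperateGrowth) :
    DualCore (mulOp g) (schwartzSubmodule d) where
  dense := dense_schwartzSubmodule d
  le := by
    rintro _ ⟨f, rfl⟩
    exact LinearPMap.mem_domain_iff.mpr ⟨_, toLp_mem_graph_mulOp hg f⟩
  symm := by
    intro x x' y y' hx hy
    rw [L2.inner_def, L2.inner_def]
    refine integral_congr_ae ?_
    filter_upwards [mem_graph_mulOp.mp hx, mem_graph_mulOp.mp hy] with a h1 h2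
    rw [h1, h2]
    simp [mul_assoc]
    ring
  dual := by
    intro ψ φ H
    rw [mem_graph_mulOp]
    refine ae_eq_of_integral_contDiff_smul_eq ((Lp.memLp φ).locallyIntegrable (by norm_num))
      (locallyIntegrable_mul_L2 hg.1.continuous ψ) fun η hη hηc => ?_
    have hη₁ : HasCompactSupport (Complex.ofRealCLM ∘ η) := hηc.comp_left rfl
    have hη₂ : ContDiff ℝ (⊤ : ℕ∞) (Complex.ofRealCLM ∘ η) := by fun_prop
    set f := hη₁.toSchwartzMap hη₂
    have hf : ∀ x, f x = (η x : ℂ) := fun x => rfl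
    have h := H _ ⟨f, rfl⟩ _ (toLp_mem_graph_mulOp hg f)
    -- Conjugation moves the test function to the antilinear slot, where it is unaffected because it
    -- is real.
    rw [← inner_conj_symm, ← inner_conj_symm ψ] at h
    have h := (starRingEnd ℂ).injective h
    rw [L2.inner_def, L2.inner_def] at h
    convert h using 1
    · refine integral_congr_ae ?_
      filter_upwards [f.coeFn_toLp 2 volume] with x h1
      change _ = inner ℂ ((f.toLp 2 volume : L2 d) x) (φ x)
      rw [h1, hf]
      simp [mul_comm]
    · refine integral_congr_ae ?_
      filter_upwards [(SchwartzMap.smulLeftCLM ℂ g f).coeFn_toLp 2 volume] with x h1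
      rw [h1, SchwartzMap.smulLeftCLM_apply_apply hg, hf]
      simp
      ring

/-- Dominated convergence in `L²`. -/
theorem tendsto_L2_of_dominated {ι : Type*} {l : Filter ι} [l.IsCountablyGenerated]
    {F : ι → L2 d} {F₀ : L2 d} {f : ι → (ℝ^d) → ℂ} {f₀ : (ℝ^d) → ℂ} {b : L2 d}
    (hF : ∀ i, ∀ᵐ x, F i x = f i x) (hF₀ : ∀ᵐ x, F₀ x = f₀ x)
    (hb : ∀ i, ∀ᵐ x, ‖f i x‖ ≤ ‖b x‖) (hb₀ : ∀ᵐ x, ‖f₀ x‖ ≤ ‖b x‖)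
    (hlim : ∀ᵐ x, Tendsto (fun i => f i x) l (𝓝 (f₀ x))) :
    Tendsto F l (𝓝 F₀) := by
  rw [tendsto_iff_norm_sub_tendsto_zero]
  have hsq : ∀ u : L2 d, ‖u‖ ^ 2 = ∫ x, ‖u x‖ ^ 2 := by
    intro u
    have := inner_self_eq_norm_sq_to_K (𝕜 := ℂ) u
    rw [L2.inner_def] at this
    have h2 : (∫ x, inner ℂ (u x) (u x)) = ((∫ x, ‖u x‖ ^ 2 : ℝ) : ℂ) := by
      rw [← integral_complex_ofReal]
      congr 1
      ext x
      rw [inner_self_eq_norm_sq_to_K]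
      simp
    rw [h2] at this
    apply Complex.ofReal_injective
    rw [Complex.ofReal_pow]
    exact this.symm
  have hint : Integrable (fun x => (2 * ‖b x‖) ^ 2) volume := by
    simp_rw [mul_pow]
    exact ((Lp.memLp b).integrable_norm_pow (by norm_num)).const_mul _
  have hae : ∀ i, ∀ᵐ x, (F i - F₀ : L2 d) x = f i x - f₀ x := by
    intro i
    filter_upwards [Lp.coeFn_sub (F i) F₀, hF i, hF₀] with x h1 h2 h3
    rw [h1, Pi.sub_apply, h2, h3]
  have h0 : Tendsto (fun i => ‖F i - F₀‖ ^ 2) l (𝓝 0) := by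
    have h2 : ∀ i, ‖F i - F₀‖ ^ 2 = ∫ x, ‖f i x - f₀ x‖ ^ 2 := fun i => by
      rw [hsq]
      exact integral_congr_ae ((hae i).mono fun x hx => by simp only [hx])
    have : (0 : ℝ) = ∫ x : ℝ^d, (0 : ℝ) := by simp
    rw [this]
    simp_rw [h2]
    refine tendsto_integral_filter_of_dominated_convergence (fun x => (2 * ‖b x‖) ^ 2)
      (Eventually.of_forall fun i => ?_) (Eventually.of_forall fun i => ?_) hint ?_
    · exact ((Lp.aestronglyMeasurable (F i - F₀)).congr (hae i)).norm.pow 2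
    · filter_upwards [hb i, hb₀] with x h2 h3
      rw [Real.norm_of_nonneg (by positivity)]
      gcongr
      exact (norm_sub_le _ _).trans (by linarith)
    · filter_upwards [hlim] with x h1
      simpa using ((tendsto_iff_norm_sub_tendsto_zero.mp h1).pow 2)
  have := h0.sqrt
  simpa using this

end Multiplication

/-! ### Criteria for being a propagator -/

section PropagatorConstruction

variable {E : Type*} [NormedAddCommGroup E] [InnerProductSpace ℂ E]

local notation "⟪" x ", " y "⟫" => inner ℂ x y

/-- A strongly continuous unitary group whose generator extends `-iH`, with `H` self-adjoint, has
generator exactly `-iH`. -/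
theorem IsPropagator.of_hasDerivAt {H : E →ₗ.[ℂ] E} {U : ℝ → E →L[ℂ] E} {C : Submodule ℂ E}
    (hH : DualCore H C) (zero : U 0 = 1) (add : ∀ s t, U (s + t) = U s * U t)
    (isometry : ∀ t ψ, ‖U t ψ‖ = ‖ψ‖) (continuous : ∀ ψ, Continuous fun t => U t ψ)
    (deriv : ∀ ψ φ, (ψ, φ) ∈ H.graph → HasDerivAt (fun t => U t ψ) ((-Complex.I) • φ) 0) :
    IsPropagator H U where
  zero := zero
  add := add
  isometry := isometry
  continuous := continuous
  generator := by
    intro ψ φ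
    constructor
    · intro h
      -- If the orbit of `ψ` is differentiable, differentiating `⟪U t ψ, U t χ⟫ = ⟪ψ, χ⟫` produces
      -- exactly the duality condition for `H`, so the generator cannot be larger than `-iH`.
      have hg : (ψ, Complex.I • φ) ∈ H.graph := hH.dual fun χ hχ χ' hχ' => by
        have h1 := h.inner ℂ (deriv χ χ' hχ')
        have hc : (fun t => ⟪U t ψ, U t χ⟫) = fun _ => ⟪ψ, χ⟫ := by
          ext t
          exact LinearIsometry.inner_map_map ⟨(U t : E →ₗ[ℂ] E), isometry t⟩ ψ χ
        rw [hc] at h1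
        have h0 := h1.unique (hasDerivAt_const (0 : ℝ) ⟪ψ, χ⟫)
        simp only [zero, one_apply_eq_self, inner_smul_right] at h0
        rw [inner_smul_left, Complex.conj_I]
        linear_combination (-Complex.I) * h0 - ⟪ψ, χ'⟫ * Complex.I_mul_I
      obtain ⟨hd, he⟩ := mem_graph_iff_exists.mp hg
      exact ⟨hd, by rw [he, smul_smul]; simp⟩
    · rintro ⟨hd, rfl⟩
      exact deriv _ _ (mk_mem_graph hd)

theorem IsPropagator.conj {H : E →ₗ.[ℂ] E} {U : ℝ → E →L[ℂ] E} (hU : IsPropagator H U)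
    (V : E ≃ₗᵢ[ℂ] E) : IsPropagator (conjOp V H) (fun t =>
      (V.symm.toContinuousLinearEquiv : E →L[ℂ] E) * U t *
        (V.toContinuousLinearEquiv : E →L[ℂ] E)) where
  zero := by
    ext ψ
    simp [hU.zero]
  add s t := by
    ext ψ
    simp [hU.add]
  isometry t ψ := by simp [hU.isometry]
  continuous ψ := V.symm.continuous.comp (hU.continuous (V ψ))
  generator := by
    intro ψ φ
    have h1 : HasDerivAt (fun t => V.symm (U t (V ψ))) φ 0 ↔
        HasDerivAt (fun t => U t (V ψ)) (V φ) 0 := by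
      constructor
      · intro h
        have := ((V.toContinuousLinearEquiv : E →L[ℂ] E).restrictScalars
          ℝ).hasFDerivAt.comp_hasDerivAt (0 : ℝ) h
        refine this.congr_of_eventuallyEq (Eventually.of_forall fun s => ?_)
        exact (V.apply_symm_apply _).symm
      · intro h
        have := ((V.symm.toContinuousLinearEquiv : E →L[ℂ] E).restrictScalars
          ℝ).hasFDerivAt.comp_hasDerivAt (0 : ℝ) h
        have h2 : V.symm (V φ) = φ := V.symm_apply_apply φ
        rw [← h2]
        exact this
    have h3 : HasDerivAt (fun t => V.symm (U t (V ψ))) φ 0 ↔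
        (ψ, Complex.I • φ) ∈ (conjOp V H).graph := by
      rw [h1, hU.hasDerivAt_zero_iff, mem_graph_conjOp, map_smul]
    refine h3.trans ?_
    rw [mem_graph_iff_exists]
    refine exists_congr fun h => ?_
    constructor
    · intro h'; rw [h']; simp [smul_smul]
    · rintro rfl; simp [smul_smul]

end PropagatorConstruction

/-! ### The unitary group `e^{-itg}` -/

section Phase

variable {d : ℕ}

local notation "ℝ^" d => EuclideanSpace ℝ (Fin d)

theorem norm_exp_phase (g : (ℝ^d) → ℝ) (t : ℝ) (x : ℝ^d) :
    ‖Complex.exp (Complex.I * ((-(t * g x) : ℝ) : ℂ))‖ = 1 := by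
  rw [mul_comm, Complex.norm_exp_ofReal_mul_I]

theorem memLp_phase {g : (ℝ^d) → ℝ} (hg : Continuous g) (t : ℝ) (ψ : L2 d) :
    MemLp (fun x => Complex.exp (Complex.I * ((-(t * g x) : ℝ) : ℂ)) * ψ x) 2 volume := by
  refine (Lp.memLp ψ).of_le ?_ (Eventually.of_forall fun x => ?_)
  · have : Continuous fun x => Complex.exp (Complex.I * ((-(t * g x) : ℝ) : ℂ)) := by fun_prop
    exact this.aestronglyMeasurable.mul (Lp.aestronglyMeasurable ψ)
  · rw [norm_mul, norm_exp_phase, one_mul]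

/-- Multiplication by `e^{-itg}` on `L²(ℝ^d)`. -/
def phaseIsometry (g : (ℝ^d) → ℝ) (hg : Continuous g) (t : ℝ) : L2 d →ₗᵢ[ℂ] L2 d :=
    { toFun := fun ψ => (memLp_phase hg t ψ).toLp
      map_add' := by
        intro ψ φ
        rw [← MemLp.toLp_add]
        apply MemLp.toLp_congr
        filter_upwards [Lp.coeFn_add ψ φ] with x hx
        simp only [hx, Pi.add_apply, mul_add]
      map_smul' := by
        intro c ψ
        refine Eq.trans ?_ (MemLp.toLp_const_smul c (memLp_phase hg t ψ))
        apply MemLp.toLp_congr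
        filter_upwards [Lp.coeFn_smul c ψ] with x hx
        simp only [hx, Pi.smul_apply, smul_eq_mul, mul_left_comm]
      norm_map' := by
        intro ψ
        refine le_antisymm (Lp.norm_le_norm_of_ae_le ?_) (Lp.norm_le_norm_of_ae_le ?_)
        all_goals
          filter_upwards [(memLp_phase hg t ψ).coeFn_toLp] with x hx
          simp only [LinearMap.coe_mk, AddHom.coe_mk]
          rw [hx, norm_mul, norm_exp_phase, one_mul] }

/-- Multiplication by `e^{-itg}` as a bounded operator. -/
def phase (g : (ℝ^d) → ℝ) (hg : Continuous g) (t : ℝ) : L2 d →L[ℂ] L2 d :=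
  (phaseIsometry g hg t).toContinuousLinearMap

theorem phase_ae (g : (ℝ^d) → ℝ) (hg : Continuous g) (t : ℝ) (ψ : L2 d) :
    ∀ᵐ x, phase g hg t ψ x = Complex.exp (Complex.I * ((-(t * g x) : ℝ) : ℂ)) * ψ x :=
  (memLp_phase hg t ψ).coeFn_toLp

theorem isPropagator_phase {g : (ℝ^d) → ℝ} (hg : g.HasTemperateGrowth)
    (hc : Continuous g) :
    IsPropagator (mulOp g) (phase g hc) := by
  refine IsPropagator.of_hasDerivAt (dualCore_mulOp hg) ?_ ?_ (fun t ψ => ?_) (fun ψ => ?_) ?_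
  · ext1 ψ
    refine Lp.ext ?_
    filter_upwards [phase_ae g hc 0 ψ] with x hx
    rw [hx]
    simp
  · intro s t
    ext1 ψ
    refine Lp.ext ?_
    rw [mul_apply_eq_comp]
    filter_upwards [phase_ae g hc (s + t) ψ, phase_ae g hc t ψ,
      phase_ae g hc s (phase g hc t ψ)] with x h1 h2 h3
    rw [h1, h3, h2, ← mul_assoc, ← Complex.exp_add]
    congr 2
    push_cast
    ring
  · exact (phaseIsometry g hc t).norm_map ψ
  · rw [continuous_iff_continuousAt]
    intro t
    refine tendsto_L2_of_dominated (b := ψ) (fun s => phase_ae g hc s ψ)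
      (phase_ae g hc t ψ) (fun s => ?_) ?_ ?_
    · exact Eventually.of_forall fun x => by rw [norm_mul, norm_exp_phase, one_mul]
    · exact Eventually.of_forall fun x => by rw [norm_mul, norm_exp_phase, one_mul]
    · refine Eventually.of_forall fun x => ?_
      have : Continuous fun s : ℝ => Complex.exp (Complex.I * ((-(s * g x) : ℝ) : ℂ)) * ψ x := by
        fun_prop
      exact this.tendsto t
  · intro ψ φ h
    rw [mem_graph_mulOp] at h
    refine hasDerivAt_iff_tendsto_slope_zero.mpr ?_
    refine tendsto_L2_of_dominated (b := φ)
      (f := fun t x => (t : ℂ)⁻¹ * (Complex.exp (Complex.I * ((-(t * g x) : ℝ) : ℂ)) - 1) * ψ x)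
      (f₀ := fun x => -Complex.I * (g x * ψ x)) (fun t => ?_) ?_ (fun t => ?_) ?_ ?_
    · filter_upwards [phase_ae g hc (0 + t) ψ, phase_ae g hc 0 ψ,
        Lp.coeFn_smul (t⁻¹) (phase g hc (0 + t) ψ - phase g hc 0 ψ),
        Lp.coeFn_sub (phase g hc (0 + t) ψ) (phase g hc 0 ψ)]
        with x h1 h2 h3 h4
      rw [h3, Pi.smul_apply, h4, Pi.sub_apply, h1, h2, Complex.real_smul]
      simp
      ring
    · filter_upwards [h, Lp.coeFn_smul (-Complex.I) φ] with x h1 h2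
      rw [h2, Pi.smul_apply, h1, smul_eq_mul]
    -- Since `|e^{is} - 1| ≤ |s|`, the difference quotients are dominated by `|gψ| = |φ|`. The bound
    -- is needed for all `t`; at `t = 0` it holds because `0⁻¹ = 0`.
    · filter_upwards [h] with x h1
      rw [h1, norm_mul, norm_mul, norm_mul]
      gcongr
      refine (mul_le_mul_of_nonneg_left Real.norm_exp_I_mul_ofReal_sub_one_le
        (norm_nonneg _)).trans ?_
      rw [norm_neg, norm_mul, norm_inv, Complex.norm_real, Complex.norm_real, ← mul_assoc]
      rcases eq_or_ne ‖t‖ 0 with h0 | h0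
      · rw [h0]; simp
      · rw [inv_mul_cancel₀ h0, one_mul]
    · filter_upwards [h] with x h1
      rw [h1, norm_mul]
      simp
    · refine Eventually.of_forall fun x => ?_
      have h1 : HasDerivAt (fun t : ℝ => Complex.exp (Complex.I * ((-(t * g x) : ℝ) : ℂ)))
          (-Complex.I * g x) 0 := by
        have h2 : HasDerivAt (fun t : ℝ => Complex.I * ((-(t * g x) : ℝ) : ℂ))
            (-Complex.I * g x) 0 := by
          have := ((((hasDerivAt_id (0 : ℝ)).mul_const (g x)).neg).ofReal_comp).const_mul Complex.I
          simpa using this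
        have := h2.cexp
        simpa using this
      rw [hasDerivAt_iff_tendsto_slope_zero] at h1
      have h2 := h1.mul_const (ψ x)
      rw [mul_assoc] at h2
      refine h2.congr fun t => ?_
      simp

end Phase

/-! ### Fourier transform, Sobolev spaces, commutator of a coordinate with a multiplier -/

section Fourier

open FourierTransform Real

variable {d : ℕ}

local notation "ℝ^" d => EuclideanSpace ℝ (Fin d)

/-- The Fourier transform on `L²(ℝ^d)`. -/
def fourierL2 (d : ℕ) : L2 d ≃ₗᵢ[ℂ] L2 d := Lp.fourierTransformₗᵢ (ℝ^d) ℂ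

theorem toDist_fourierL2 (ψ : L2 d) : toDist d (fourierL2 d ψ) = 𝓕 (toDist d ψ) :=
  (Lp.fourier_toTemperedDistribution_eq ψ).symm

theorem fourierL2_toLp (f : 𝓢(ℝ^d, ℂ)) :
    fourierL2 d (f.toLp 2 volume) = (𝓕 f).toLp 2 volume :=
  SchwartzMap.toLp_fourier_eq f

/-- This invariance makes the Schwartz space a common core for multiplication operators and for
Fourier multipliers. -/
theorem comap_fourierL2_schwartzSubmodule (d : ℕ) :
    (schwartzSubmodule d).comap ((fourierL2 d).toLinearEquiv : L2 d →ₗ[ℂ] L2 d) =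
      schwartzSubmodule d := by
  ext ψ
  constructor
  · rintro ⟨f, hf⟩
    refine ⟨𝓕⁻ f, (fourierL2 d).injective ?_⟩
    have := fourierL2_toLp (𝓕⁻ f)
    rw [fourier_fourierInv_eq] at this
    exact this.trans hf
  · rintro ⟨f, rfl⟩
    exact ⟨𝓕 f, (fourierL2_toLp f).symm⟩

/-- The bridge between distributional multiplication, in which `H^s` and `Δ` are expressed, and the
maximal multiplication operator on `L²`. -/
theorem smulLeftCLM_toDist_eq_iff {g : (ℝ^d) → ℝ} (hg : g.HasTemperateGrowth) (hc : Continuous g)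
    {ψ φ : L2 d} :
    TemperedDistribution.smulLeftCLM ℂ (fun x => (g x : ℂ)) (toDist d ψ) = toDist d φ ↔
      (ψ, φ) ∈ (mulOp g).graph := by
  have hg' : (fun x => (g x : ℂ)).HasTemperateGrowth := by fun_prop
  have happly : ∀ (χ : L2 d) (u : 𝓢(ℝ^d, ℂ)), toDist d χ u = ∫ x, u x • χ x := fun χ u =>
    Lp.toTemperedDistribution_apply χ u
  have hsmul : ∀ u : 𝓢(ℝ^d, ℂ),
      TemperedDistribution.smulLeftCLM ℂ (fun x => (g x : ℂ)) (toDist d ψ) u =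
        ∫ x, u x • ((g x : ℂ) * ψ x) := by
    intro u
    rw [TemperedDistribution.smulLeftCLM_apply_apply, happly]
    congr 1
    ext x
    rw [SchwartzMap.smulLeftCLM_apply_apply hg']
    simp only [smul_eq_mul]
    ring
  rw [mem_graph_mulOp]
  constructor
  · intro h
    refine ae_eq_of_integral_contDiff_smul_eq ((Lp.memLp φ).locallyIntegrable (by norm_num))
      (locallyIntegrable_mul_L2 hc ψ) fun η hη hηc => ?_
    have hη₁ : HasCompactSupport (Complex.ofRealCLM ∘ η) := hηc.comp_left rfl
    have hη₂ : ContDiff ℝ (⊤ : ℕ∞) (Complex.ofRealCLM ∘ η) := by fun_prop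
    have h1 := hsmul (hη₁.toSchwartzMap hη₂)
    rw [h, happly] at h1
    exact h1
  · intro h
    ext u
    rw [hsmul, happly]
    refine integral_congr_ae ?_
    filter_upwards [h] with x hx
    rw [hx]

theorem memSobolev_iff_mem_domain {s : ℝ} {ψ : L2 d} :
    TemperedDistribution.MemSobolev s 2 (toDist d ψ) ↔
      fourierL2 d ψ ∈ (mulOp fun x : ℝ^d => (1 + ‖x‖ ^ 2) ^ (s / 2)).domain := by
  rw [TemperedDistribution.memSobolev_iff_exists_smulLeftCLM_fourier, ← toDist_fourierL2,
    LinearPMap.mem_domain_iff]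
  have hg : (fun x : ℝ^d => (1 + ‖x‖ ^ 2) ^ (s / 2)).HasTemperateGrowth := by fun_prop
  refine exists_congr fun φ => ?_
  exact smulLeftCLM_toDist_eq_iff hg hg.1.continuous

/-- The symbol `(2π)² |ξ|²` of `-Δ`. -/
def laplaceSymbol (d : ℕ) (x : ℝ^d) : ℝ := (2 * π) ^ 2 * ‖x‖ ^ 2

@[fun_prop]
theorem hasTemperateGrowth_laplaceSymbol (d : ℕ) : (laplaceSymbol d).HasTemperateGrowth := by
  unfold laplaceSymbol
  fun_prop

theorem continuous_laplaceSymbol (d : ℕ) : Continuous (laplaceSymbol d) :=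
  (hasTemperateGrowth_laplaceSymbol d).1.continuous

theorem toDist_eq_neg_laplacian_iff {ψ φ : L2 d} :
    toDist d φ = -Δ (toDist d ψ) ↔
      (fourierL2 d ψ, fourierL2 d φ) ∈ (mulOp (laplaceSymbol d)).graph := by
  have hg : (fun x : ℝ^d => ‖x‖ ^ 2).HasTemperateGrowth := by fun_prop
  have hc : ((2 * π) ^ 2 : ℝ) ≠ 0 := by positivity
  have h1 : mulOp (laplaceSymbol d) = (((2 * π) ^ 2 : ℝ) : ℂ) • mulOp fun x : ℝ^d => ‖x‖ ^ 2 :=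
    (smul_mulOp hc).symm
  rw [h1, mem_graph_smul]
  have h2 : toDist d φ = -Δ (toDist d ψ) ↔ 𝓕 (toDist d φ) = 𝓕 (-Δ (toDist d ψ)) :=
    ⟨fun h => by rw [h], fun h => by
      have := congrArg (𝓕⁻ : 𝓢'(ℝ^d, ℂ) → 𝓢'(ℝ^d, ℂ)) h
      simpa using this⟩
  have h3 : 𝓕 (-Δ (toDist d ψ)) = (((2 * π) ^ 2 : ℝ) : ℂ) •
      TemperedDistribution.smulLeftCLM ℂ (fun x : ℝ^d => ((‖x‖ ^ 2 : ℝ) : ℂ))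
        (toDist d (fourierL2 d ψ)) := by
    rw [TemperedDistribution.laplacian_eq_fourierMultiplierCLM, toDist_fourierL2,
      TemperedDistribution.fourierMultiplierCLM_apply]
    rw [← Complex.coe_smul, ← neg_smul, FourierTransform.fourier_smul, fourier_fourierInv_eq]
    simp
  rw [h2, h3, ← toDist_fourierL2]
  have hc' : (((2 * π) ^ 2 : ℝ) : ℂ) ≠ 0 := by exact_mod_cast hc
  constructor
  · intro h
    refine ⟨(((2 * π) ^ 2 : ℝ) : ℂ)⁻¹ • fourierL2 d φ, ?_, by
      rw [smul_smul, mul_inv_cancel₀ hc', one_smul]⟩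
    rw [← smulLeftCLM_toDist_eq_iff hg hg.1.continuous, map_smul, h, smul_smul,
      inv_mul_cancel₀ hc', one_smul]
  · rintro ⟨y, hy, h⟩
    rw [← h, map_smul, (smulLeftCLM_toDist_eq_iff hg hg.1.continuous).mpr hy]

/-- For `ψ ∈ L²`, the conditions `|ξ|² ψ̂ ∈ L²` and `(1 + |ξ|²) ψ̂ ∈ L²` are equivalent, so `H²` is
the maximal domain of the Fourier multiplier. -/
theorem freeHamiltonian_eq (d : ℕ) :
    freeHamiltonian d = conjOp (fourierL2 d) (mulOp (laplaceSymbol d)) := by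
  refine eq_of_forall_mem_graph_iff fun ψ φ => ?_
  rw [mem_graph_conjOp, ← toDist_eq_neg_laplacian_iff, mem_graph_iff_exists]
  have hspec : ∀ h : ψ ∈ (freeHamiltonian d).domain,
      toDist d (freeHamiltonian d ⟨ψ, h⟩) = -Δ (toDist d ψ) := fun h =>
    (exists_laplacian ⟨ψ, h⟩).choose_spec
  constructor
  · rintro ⟨h, rfl⟩
    exact hspec h
  · intro h
    have hd : ψ ∈ (freeHamiltonian d).domain := by
      change TemperedDistribution.MemSobolev 2 2 (toDist d ψ)
      rw [memSobolev_iff_mem_domain]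
      rw [toDist_eq_neg_laplacian_iff] at h
      -- The witness is `(1 + |ξ|²) ψ̂`, rewritten through `φ̂ = (2π)² |ξ|² ψ̂`.
      refine LinearPMap.mem_domain_iff.mpr
        ⟨fourierL2 d ψ + (((2 * π) ^ 2 : ℝ) : ℂ)⁻¹ • fourierL2 d φ, mem_graph_mulOp.mpr ?_⟩
      filter_upwards [mem_graph_mulOp.mp h, Lp.coeFn_add (fourierL2 d ψ)
        ((((2 * π) ^ 2 : ℝ) : ℂ)⁻¹ • fourierL2 d φ),
        Lp.coeFn_smul (((2 * π) ^ 2 : ℝ) : ℂ)⁻¹ (fourierL2 d φ)] with x h1 h2 h3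
      have hc' : (((2 * π) ^ 2 : ℝ) : ℂ) ≠ 0 := by
        exact_mod_cast (by positivity : ((2 * π) ^ 2 : ℝ) ≠ 0)
      rw [h2, Pi.add_apply, h3, Pi.smul_apply, h1, smul_eq_mul, laplaceSymbol, Complex.ofReal_mul,
        mul_assoc, inv_mul_cancel_left₀ hc']
      simp
      ring
    exact ⟨hd, toDist_injective d ((hspec hd).trans h.symm)⟩

/-- The commutator of a coordinate with a Fourier multiplier. -/
theorem smulLeftCLM_coord_fourierMultiplierCLM {g g' : (ℝ^d) → ℂ} (hg : g.HasTemperateGrowth)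
    (hg' : g'.HasTemperateGrowth) (j : Fin d)
    (hd : ∀ x, HasLineDerivAt ℝ g (g' x) x (EuclideanSpace.single j 1)) (f : 𝓢(ℝ^d, ℂ)) :
    SchwartzMap.smulLeftCLM ℂ (fun x : ℝ^d => x j) (SchwartzMap.fourierMultiplierCLM ℂ g f) =
      SchwartzMap.fourierMultiplierCLM ℂ g (SchwartzMap.smulLeftCLM ℂ (fun x : ℝ^d => x j) f) +
        (Complex.I / (2 * π)) • SchwartzMap.fourierMultiplierCLM ℂ g' f := by
  set m : ℝ^d := EuclideanSpace.single j 1 with hm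
  have hcoord : (fun x : ℝ^d => x j) = (inner ℝ · m) := by
    ext x
    simp [hm, EuclideanSpace.inner_single_right]
  have hpi : (2 * π * Complex.I : ℂ) ≠ 0 := by simp [Real.pi_ne_zero]
  -- Leibniz rule on the Fourier side; the inverse transform turns `∂_m` into multiplication by
  -- `-2πi x_j`.
  have hprod : ∂_{m} (SchwartzMap.smulLeftCLM ℂ g (𝓕 f)) =
      SchwartzMap.smulLeftCLM ℂ g' (𝓕 f) + SchwartzMap.smulLeftCLM ℂ g (∂_{m} (𝓕 f)) := by
    ext x
    have h1 : HasLineDerivAt ℝ (𝓕 f : 𝓢(ℝ^d, ℂ)) (∂_{m} (𝓕 f) x) x m := by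
      rw [SchwartzMap.lineDerivOp_apply]
      exact ((𝓕 f).differentiableAt.lineDifferentiableAt).hasLineDerivAt
    have h2 := HasDerivAt.mul (hd x) h1
    rw [SchwartzMap.lineDerivOp_apply, add_apply,
      SchwartzMap.smulLeftCLM_apply_apply hg', SchwartzMap.smulLeftCLM_apply_apply hg,
      SchwartzMap.smulLeftCLM_apply hg]
    have h3 : HasLineDerivAt ℝ (fun x => g x • (𝓕 f) x)
      (g' x • (𝓕 f) x + g x • ∂_{m} (𝓕 f) x) x m := by
      simp only [zero_smul, add_zero] at h2
      exact h2
    exact h3.lineDeriv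
  have h1 := SchwartzMap.fourierInv_lineDerivOp_eq (SchwartzMap.smulLeftCLM ℂ g (𝓕 f)) m
  rw [hprod, SchwartzMap.lineDerivOp_fourier_eq, FourierTransform.fourier_smul, map_smul,
    FourierTransform.fourierInv_add, FourierTransform.fourierInv_smul] at h1
  rw [hcoord]
  simp only [SchwartzMap.fourierMultiplierCLM_apply]
  -- Division by `-2πi` produces the constant `i/(2π)` in front of the derivative term.
  have h2 := congrArg (fun u : 𝓢(ℝ^d, ℂ) => (-(2 * π * Complex.I))⁻¹ • u) h1
  simp only [smul_add, smul_smul] at h2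
  rw [inv_mul_cancel₀ (neg_ne_zero.mpr hpi), one_smul, one_smul] at h2
  rw [← h2, add_comm]
  congr 2
  field_simp
  simp

end Fourier

/-! ### Momentum and free propagator on `L²(ℝ^d)` -/

section Continuum

open FourierTransform Real

variable {d : ℕ}

local notation "ℝ^" d => EuclideanSpace ℝ (Fin d)

theorem hasTemperateGrowth_coord (j : Fin d) : (fun x : ℝ^d => x j).HasTemperateGrowth :=
  (EuclideanSpace.proj j : (ℝ^d) →L[ℝ] ℝ).hasTemperateGrowth

theorem dualCore_position (j : Fin d) : DualCore (position d j) (schwartzSubmodule d) := by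
  rw [position_eq_mulOp]
  exact dualCore_mulOp (hasTemperateGrowth_coord j)

theorem toLp_mem_graph_position (j : Fin d) (f : 𝓢(ℝ^d, ℂ)) :
    (f.toLp 2 volume, (SchwartzMap.smulLeftCLM ℂ (fun x : ℝ^d => x j) f).toLp 2 volume) ∈
      (position d j).graph :=
  toLp_mem_graph_mulOp (hasTemperateGrowth_coord j) f

theorem dualCore_conjOp_mulOp {g : (ℝ^d) → ℝ} (hg : g.HasTemperateGrowth) :
    DualCore (conjOp (fourierL2 d) (mulOp g)) (schwartzSubmodule d) := by
  have := (dualCore_mulOp hg).conjOp (fourierL2 d)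
  rwa [comap_fourierL2_schwartzSubmodule] at this

theorem toLp_mem_graph_conjOp_mulOp {g : (ℝ^d) → ℝ} (hg : g.HasTemperateGrowth)
    (f : 𝓢(ℝ^d, ℂ)) :
    (f.toLp 2 volume,
      (SchwartzMap.fourierMultiplierCLM ℂ (fun x => (g x : ℂ)) f).toLp 2 volume) ∈
      (conjOp (fourierL2 d) (mulOp g)).graph := by
  rw [mem_graph_conjOp, fourierL2_toLp, fourierL2_toLp, SchwartzMap.fourierMultiplierCLM_apply,
    fourier_fourierInv_eq]
  have := SchwartzMap.smulLeftCLM_ofReal ℂ hg (𝓕 f)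
  rw [RCLike.ofReal_eq_complex_ofReal] at this
  rw [this]
  exact toLp_mem_graph_mulOp hg (𝓕 f)

theorem hasLineDerivAt_laplaceSymbol (j : Fin d) (x : ℝ^d) :
    HasLineDerivAt ℝ (laplaceSymbol d) (8 * π ^ 2 * x j) x (EuclideanSpace.single j 1) := by
  have h : HasFDerivAt (fun x : ℝ^d => ‖x‖ ^ 2) (2 • (innerSL ℝ x)) x :=
    (hasStrictFDerivAt_norm_sq x).hasFDerivAt
  have h1 := (h.const_mul ((2 * π) ^ 2)).hasLineDerivAt (EuclideanSpace.single j 1)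
  refine HasDerivAt.congr_deriv h1 ?_
  simp [EuclideanSpace.inner_single_right]
  ring

/-- The symbol `4π ξ_j` of `-2i ∂_j`. -/
def momentumSymbol (j : Fin d) (x : ℝ^d) : ℝ := 4 * π * x j

theorem hasTemperateGrowth_momentumSymbol (j : Fin d) :
    (momentumSymbol j).HasTemperateGrowth :=
  (Function.HasTemperateGrowth.const (4 * π)).mul (hasTemperateGrowth_coord j)

/-- On Schwartz functions the commutator has symbol `(i/2π) ∂_j((2π)²|ξ|²) = i · 4πξ_j`;
`maxCommutator_eq` then handles the maximal domain. -/
theorem momentum_eq (j : Fin d) :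
    momentum d j = conjOp (fourierL2 d) (mulOp (momentumSymbol j)) := by
  have hH := dualCore_conjOp_mulOp (hasTemperateGrowth_laplaceSymbol d)
  have hg : (fun x => (laplaceSymbol d x : ℂ)).HasTemperateGrowth := by fun_prop
  have hm := hasTemperateGrowth_momentumSymbol j
  have hm' : (fun x => (momentumSymbol j x : ℂ)).HasTemperateGrowth := by fun_prop
  have hg' : (fun x : ℝ^d => (((2 * π : ℝ) : ℂ) • fun x => (momentumSymbol j x : ℂ)) x).HasTemperateGrowth :=
    (Function.HasTemperateGrowth.const ((2 * π : ℝ) : ℂ)).mul hm'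
  rw [momentum, freeHamiltonian_eq]
  refine maxCommutator_eq (dualCore_conjOp_mulOp hm)
    (dualCore_position j).symm hH.symm ?_
  rintro _ ⟨f, rfl⟩
  refine ⟨_, toLp_mem_graph_conjOp_mulOp hm f,
    mem_graph_commutator.mpr ⟨_, _, _, _,
      toLp_mem_graph_conjOp_mulOp (hasTemperateGrowth_laplaceSymbol d) f,
      toLp_mem_graph_position j _, toLp_mem_graph_position j f,
      toLp_mem_graph_conjOp_mulOp (hasTemperateGrowth_laplaceSymbol d) _, ?_⟩⟩
  rw [smulLeftCLM_coord_fourierMultiplierCLM hg hg' j]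
  · simp only [← SchwartzMap.toLpCLM_apply (𝕜 := ℂ)]
    rw [map_add, add_sub_cancel_left, map_smul]
    change _ • (SchwartzMap.toLpCLM ℂ ℂ 2 volume) ((SchwartzMap.fourierMultiplierCLM ℂ
      (((2 * π : ℝ) : ℂ) • fun x => (momentumSymbol j x : ℂ))) f) = _
    rw [SchwartzMap.fourierMultiplierCLM_smul hm', smul_apply, map_smul, smul_smul]
    congr 1
    have : (π : ℂ) ≠ 0 := by simp [Real.pi_ne_zero]
    push_cast
    field_simp
  · intro x
    have := (hasLineDerivAt_laplaceSymbol j x).ofReal_comp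
    refine HasDerivAt.congr_deriv this ?_
    simp [momentumSymbol]
    ring

theorem dualCore_momentum (j : Fin d) : DualCore (momentum d j) (schwartzSubmodule d) := by
  rw [momentum_eq]
  exact dualCore_conjOp_mulOp (hasTemperateGrowth_momentumSymbol j)

theorem dualCore_freeHamiltonian (d : ℕ) :
    DualCore (freeHamiltonian d) (schwartzSubmodule d) := by
  rw [freeHamiltonian_eq]
  exact dualCore_conjOp_mulOp (hasTemperateGrowth_laplaceSymbol d)

/-- The free propagator `e^{itΔ}` on `L²(ℝ^d)`. -/
def freePropagator (d : ℕ) (t : ℝ) : L2 d →L[ℂ] L2 d :=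
  ((fourierL2 d).symm.toContinuousLinearEquiv : L2 d →L[ℂ] L2 d) *
    phase (laplaceSymbol d) (continuous_laplaceSymbol d) t *
    ((fourierL2 d).toContinuousLinearEquiv : L2 d →L[ℂ] L2 d)

theorem isPropagator_freePropagator (d : ℕ) :
    IsPropagator (freeHamiltonian d) (freePropagator d) := by
  rw [freeHamiltonian_eq]
  exact (isPropagator_phase (hasTemperateGrowth_laplaceSymbol d)
    (continuous_laplaceSymbol d)).conj (fourierL2 d)

/-- The symbol `e^{-it(2π)²|ξ|²}` of the free propagator. -/
def phaseSymbol (d : ℕ) (t : ℝ) (x : ℝ^d) : ℂ :=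
  Complex.exp (Complex.I * ((-(t * laplaceSymbol d x) : ℝ) : ℂ))

/-- All derivatives have modulus `1`. This is what makes the propagator act on the Schwartz space.
-/
theorem hasTemperateGrowth_exp_I_mul :
    (fun s : ℝ => Complex.exp (Complex.I * (s : ℂ))).HasTemperateGrowth := by
  have hder : ∀ n : ℕ, iteratedDeriv n (fun s : ℝ => Complex.exp (Complex.I * (s : ℂ))) =
      fun s : ℝ => Complex.I ^ n * Complex.exp (Complex.I * (s : ℂ)) := by
    intro n
    induction n with
    | zero => simp
    | succ n ih =>
      rw [iteratedDeriv_succ, ih]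
      ext s
      have h : HasDerivAt (fun s : ℝ => Complex.exp (Complex.I * (s : ℂ)))
          (Complex.exp (Complex.I * (s : ℂ)) * (Complex.I * 1)) s :=
        (((hasDerivAt_id s).ofReal_comp).const_mul Complex.I).cexp
      rw [(h.const_mul (Complex.I ^ n)).deriv]
      ring
  refine ⟨?_, fun n => ⟨0, 1, fun s => ?_⟩⟩
  · exact Complex.contDiff_exp.comp (contDiff_const.mul Complex.ofRealCLM.contDiff)
  · rw [norm_iteratedFDeriv_eq_norm_iteratedDeriv, hder, norm_mul, norm_pow, Complex.norm_I,
      mul_comm Complex.I, Complex.norm_exp_ofReal_mul_I]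
    simp

@[fun_prop]
theorem hasTemperateGrowth_phaseSymbol (d : ℕ) (t : ℝ) :
    (phaseSymbol d t).HasTemperateGrowth := by
  have h : (fun x => -(t * laplaceSymbol d x)).HasTemperateGrowth := by fun_prop
  exact hasTemperateGrowth_exp_I_mul.comp h

theorem freePropagator_toLp (t : ℝ) (f : 𝓢(ℝ^d, ℂ)) :
    freePropagator d t (f.toLp 2 volume) =
      (SchwartzMap.fourierMultiplierCLM ℂ (phaseSymbol d t) f).toLp 2 volume := by
  apply (fourierL2 d).injective
  rw [fourierL2_toLp, SchwartzMap.fourierMultiplierCLM_apply, fourier_fourierInv_eq]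
  change fourierL2 d ((fourierL2 d).symm (phase _ _ t (fourierL2 d (f.toLp 2 volume)))) = _
  rw [LinearIsometryEquiv.apply_symm_apply, fourierL2_toLp]
  refine Lp.ext ?_
  filter_upwards [phase_ae (laplaceSymbol d) (continuous_laplaceSymbol d) t ((𝓕 f).toLp 2 volume),
    (𝓕 f).coeFn_toLp 2 volume,
    (SchwartzMap.smulLeftCLM ℂ (phaseSymbol d t) (𝓕 f)).coeFn_toLp 2 volume] with x h1 h2 h3
  rw [h1, h2, h3, SchwartzMap.smulLeftCLM_apply_apply (hasTemperateGrowth_phaseSymbol d t)]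
  rfl

theorem freePropagator_mem_schwartzSubmodule (t : ℝ) {χ : L2 d} (hχ : χ ∈ schwartzSubmodule d) :
    freePropagator d t χ ∈ schwartzSubmodule d := by
  obtain ⟨f, rfl⟩ := hχ
  exact ⟨_, (freePropagator_toLp t f).symm⟩

theorem hasLineDerivAt_phaseSymbol (t : ℝ) (j : Fin d) (x : ℝ^d) :
    HasLineDerivAt ℝ (phaseSymbol d t)
      (-Complex.I * (2 * π) * t * (phaseSymbol d t x * momentumSymbol j x)) x
      (EuclideanSpace.single j 1) := by
  have h1 : HasDerivAt (fun s : ℝ => Complex.I * ((-(t * laplaceSymbol d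
      (x + s • EuclideanSpace.single j 1)) : ℝ) : ℂ)) _ 0 :=
    ((((hasLineDerivAt_laplaceSymbol j x).const_mul t).neg).ofReal_comp).const_mul Complex.I
  have h2 := h1.cexp
  refine HasDerivAt.congr_deriv h2 ?_
  simp [phaseSymbol, momentumSymbol]
  ring

/-- With `p` the phase symbol, `(i/2π) ∂_j p = t · p · 4πξ_j`: commuting `x_j` past the propagator
produces exactly `tΞ_j`. -/
theorem position_freePropagator_of_schwartz (t : ℝ) (j : Fin d) (f : 𝓢(ℝ^d, ℂ)) :
    ∃ q m, (f.toLp 2 volume, q) ∈ (position d j).graph ∧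
      (f.toLp 2 volume, m) ∈ (momentum d j).graph ∧
      (freePropagator d t (f.toLp 2 volume), freePropagator d t (q + (t : ℂ) • m)) ∈
        (position d j).graph := by
  have hm := hasTemperateGrowth_momentumSymbol j
  have hm' : (fun x => (momentumSymbol j x : ℂ)).HasTemperateGrowth := by fun_prop
  have hp := hasTemperateGrowth_phaseSymbol d t
  have hpm : (phaseSymbol d t * fun x => (momentumSymbol j x : ℂ)).HasTemperateGrowth :=
    hp.mul hm'
  set c : ℂ := -Complex.I * (2 * π) * t with hc
  have hg' : (c • (phaseSymbol d t * fun x => (momentumSymbol j x : ℂ))).HasTemperateGrowth :=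
    (Function.HasTemperateGrowth.const c).mul hpm
  rw [momentum_eq]
  refine ⟨_, _, toLp_mem_graph_position j f, toLp_mem_graph_conjOp_mulOp hm f, ?_⟩
  have hsum : (SchwartzMap.smulLeftCLM ℂ (fun x : ℝ^d => x j) f).toLp 2 volume +
      (t : ℂ) • (SchwartzMap.fourierMultiplierCLM ℂ (fun x => (momentumSymbol j x : ℂ)) f).toLp 2
        volume = (SchwartzMap.smulLeftCLM ℂ (fun x : ℝ^d => x j) f +
      (t : ℂ) • SchwartzMap.fourierMultiplierCLM ℂ (fun x => (momentumSymbol j x : ℂ)) f).toLp 2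
        volume := rfl
  rw [hsum, freePropagator_toLp, freePropagator_toLp]
  have key := smulLeftCLM_coord_fourierMultiplierCLM hp hg' j
    (fun x => hasLineDerivAt_phaseSymbol t j x) f
  have hmul : SchwartzMap.fourierMultiplierCLM ℂ (phaseSymbol d t)
      (SchwartzMap.smulLeftCLM ℂ (fun x : ℝ^d => x j) f + (t : ℂ) •
        SchwartzMap.fourierMultiplierCLM ℂ (fun x => (momentumSymbol j x : ℂ)) f) =
      SchwartzMap.smulLeftCLM ℂ (fun x : ℝ^d => x j)
        (SchwartzMap.fourierMultiplierCLM ℂ (phaseSymbol d t) f) := by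
    rw [key, map_add, map_smul, SchwartzMap.fourierMultiplierCLM_smul hpm,
      SchwartzMap.fourierMultiplierCLM_fourierMultiplierCLM_apply hp hm', smul_apply, smul_smul]
    congr 2
    have : (π : ℂ) ≠ 0 := by simp [Real.pi_ne_zero]
    rw [hc]
    field_simp
    simp
  rw [hmul]
  exact toLp_mem_graph_position j _

end Continuum

/-! ### Large-time limits from the Heisenberg relation -/

section Asymptotics

variable {E : Type*} [NormedAddCommGroup E] [InnerProductSpace ℂ E]

theorem tendsto_inv_smul_vecHeisenberg {d : ℕ} {U : ℝ → E →L[ℂ] E} {Q M : Fin d → E →ₗ.[ℂ] E}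
    (h : ∀ t : ℝ, vec Q + (t : ℂ) • vec M ≤ vecHeisenberg U Q t) (ψ : E)
    (hQ : ψ ∈ (vec Q).domain) (hM : ψ ∈ (vec M).domain) :
    ∃ h : ∀ t, ψ ∈ (vecHeisenberg U Q t).domain,
      Tendsto (fun t : ℝ => (t : ℂ)⁻¹ • vecHeisenberg U Q t ⟨ψ, h t⟩) atTop
        (𝓝 (vec M ⟨ψ, hM⟩)) := by
  have hg : ∀ t : ℝ, (ψ, vec Q ⟨ψ, hQ⟩ + (t : ℂ) • vec M ⟨ψ, hM⟩) ∈ (vecHeisenberg U Q t).graph :=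
    fun t => LinearPMap.le_graph_of_le (h t) (mem_graph_add.mpr
      ⟨_, _, mk_mem_graph hQ, mem_graph_smul.mpr ⟨_, mk_mem_graph hM, rfl⟩, rfl⟩)
  have hd : ∀ t, ψ ∈ (vecHeisenberg U Q t).domain := fun t =>
    LinearPMap.mem_domain_iff.mpr ⟨_, hg t⟩
  refine ⟨hd, ?_⟩
  have hinv : Tendsto (fun t : ℝ => (t : ℂ)⁻¹) atTop (𝓝 0) := by
    have := (Complex.continuous_ofReal.tendsto 0).comp tendsto_inv_atTop_zero
    simpa [Function.comp_def] using this
  have hlim : Tendsto (fun t : ℝ => (t : ℂ)⁻¹ • vec Q ⟨ψ, hQ⟩ + vec M ⟨ψ, hM⟩) atTop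
      (𝓝 (vec M ⟨ψ, hM⟩)) := by
    simpa using (hinv.smul_const (vec Q ⟨ψ, hQ⟩)).add_const (vec M ⟨ψ, hM⟩)
  refine hlim.congr' ?_
  filter_upwards [eventually_ne_atTop 0] with t ht
  have ht' : (t : ℂ) ≠ 0 := by exact_mod_cast ht
  rw [apply_eq_of_mem_graph (hg t) (hd t), smul_add, smul_smul, inv_mul_cancel₀ ht', one_smul]

/-- For `χ` in the common core and `t ≠ 0`, `t⁻¹ Q(t)χ = t⁻¹ Qχ + Mχ`, which tends to `Mχ`; unitary
conjugation and nonzero real scaling keep the operators self-adjoint. -/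
theorem strongResolventTendsto_heisenberg [CompleteSpace E] {H : E →ₗ.[ℂ] E}
    {U : ℝ → E →L[ℂ] E} (hU : IsPropagator H U) {Q M : E →ₗ.[ℂ] E} {C : Submodule ℂ E}
    (hQ : DualCore Q C) (hM : DualCore M C)
    (h : ∀ (t : ℝ) ψ q m, (ψ, q) ∈ Q.graph → (ψ, m) ∈ M.graph →
      (ψ, q + (t : ℂ) • m) ∈ (heisenberg U Q t).graph) :
    StrongResolventTendsto (fun t : ℝ => (t : ℂ)⁻¹ • heisenberg U Q t) atTop M := by
  refine strongResolventTendsto_of_core ?_ hM fun χ hχ b hb => ?_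
  · filter_upwards [eventually_ne_atTop 0] with t ht
    rw [hU.heisenberg_eq, ← Complex.ofReal_inv]
    exact ((hQ.conjOp _).smul (inv_ne_zero ht)).isSelfAdjoint
  · obtain ⟨q, hq⟩ := LinearPMap.mem_domain_iff.mp (hQ.le hχ)
    have hinv : Tendsto (fun t : ℝ => (t : ℂ)⁻¹) atTop (𝓝 0) := by
      have := (Complex.continuous_ofReal.tendsto 0).comp tendsto_inv_atTop_zero
      simpa [Function.comp_def] using this
    refine ⟨fun t => (t : ℂ)⁻¹ • q + b, ?_, by simpa using (hinv.smul_const q).add_const b⟩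
    filter_upwards [eventually_ne_atTop 0] with t ht
    have ht' : (t : ℂ) ≠ 0 := by exact_mod_cast ht
    refine mem_graph_smul.mpr ⟨_, h t χ q b hq hb, ?_⟩
    rw [smul_add, smul_smul, inv_mul_cancel₀ ht', one_smul]

end Asymptotics

/-! ### The domain of `Ξ`, joint core of the positions, closure of `Q + tΞ` -/

section Continuum

open FourierTransform Real

variable {d : ℕ}

local notation "ℝ^" d => EuclideanSpace ℝ (Fin d)

theorem norm_le_one_add_norm_sq_rpow (x : ℝ^d) : ‖x‖ ≤ (1 + ‖x‖ ^ 2) ^ (1 / 2 : ℝ) := by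
  rw [← Real.sqrt_eq_rpow]
  exact Real.le_sqrt_of_sq_le (by linarith)

theorem one_add_norm_sq_rpow_le (x : ℝ^d) :
    (1 + ‖x‖ ^ 2) ^ (1 / 2 : ℝ) ≤ 1 + ∑ j, |x j| := by
  have h1 : ‖x‖ ≤ ∑ j, |x j| := by
    calc ‖x‖ = ‖∑ j, x j • EuclideanSpace.single j (1 : ℝ)‖ := by
          congr 1
          ext i
          simp [Finset.sum_apply, Pi.single_apply]
      _ ≤ ∑ j, ‖x j • EuclideanSpace.single j (1 : ℝ)‖ := norm_sum_le _ _
      _ = _ := by simp [norm_smul]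
  rw [← Real.sqrt_eq_rpow, Real.sqrt_le_left (by positivity)]
  nlinarith [norm_nonneg x]

/-- The weights are comparable: `|x_j| ≤ (1 + |x|²)^{1/2} ≤ 1 + ∑ |x_j|`. On the Fourier side this
is `D(Ξ) = H¹`. -/
theorem forall_coord_mem_domain_iff {ψ : L2 d} :
    (∀ j, ψ ∈ (mulOp fun x : ℝ^d => x j).domain) ↔
      ψ ∈ (mulOp fun x : ℝ^d => (1 + ‖x‖ ^ 2) ^ (1 / 2 : ℝ)).domain := by
  simp only [mem_mulOp_domain]
  have hW : Continuous fun x : ℝ^d => (1 + ‖x‖ ^ 2) ^ (1 / 2 : ℝ) :=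
    (Function.hasTemperateGrowth_one_add_norm_sq_rpow (ℝ^d) (1 / 2)).1.continuous
  constructor
  · intro h
    have h1 : MemLp (fun x => ‖ψ x‖ + ∑ j, ‖((x j : ℝ) : ℂ) * ψ x‖) 2 volume :=
      (Lp.memLp ψ).norm.add (memLp_finsetSum _ fun j _ => (h j).norm)
    refine h1.of_le ((Complex.continuous_ofReal.comp hW).aestronglyMeasurable.mul
      (Lp.aestronglyMeasurable ψ)) (Eventually.of_forall fun x => ?_)
    rw [norm_mul, Complex.norm_real, Real.norm_of_nonneg (by positivity),
      Real.norm_of_nonneg (by positivity)]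
    calc _ ≤ (1 + ∑ j, |x j|) * ‖ψ x‖ := by gcongr; exact one_add_norm_sq_rpow_le x
      _ = _ := by simp [add_mul, Finset.sum_mul]
  · intro h j
    refine h.of_le ((Complex.continuous_ofReal.comp
      (hasTemperateGrowth_coord j).1.continuous).aestronglyMeasurable.mul
      (Lp.aestronglyMeasurable ψ)) (Eventually.of_forall fun x => ?_)
    rw [norm_mul, norm_mul, Complex.norm_real, Complex.norm_real]
    gcongr
    refine ((PiLp.norm_apply_le x j).trans (norm_le_one_add_norm_sq_rpow x)).trans (le_abs_self _)

theorem mem_vec_momentum_domain {ψ : L2 d} :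
    ψ ∈ (vec (momentum d)).domain ↔
      TemperedDistribution.MemSobolev 1 2 (toDist d ψ) := by
  rw [memSobolev_iff_mem_domain, ← forall_coord_mem_domain_iff, mem_vec_domain]
  refine forall_congr' fun j => ?_
  have : mulOp (momentumSymbol j) = ((4 * π : ℝ) : ℂ) • mulOp fun x : ℝ^d => x j :=
    (smul_mulOp (by positivity)).symm
  rw [momentum_eq, this]
  rfl

theorem norm_sub_le_of_mul {ψ φ u w : L2 d} {m : (ℝ^d) → ℝ} (hm : ∀ x, |m x| ≤ 1)
    (h1 : ∀ᵐ x, φ x = m x * u x) (h2 : ∀ᵐ x, ψ x = m x * w x) : ‖φ - ψ‖ ≤ ‖u - w‖ := by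
  refine Lp.norm_le_norm_of_ae_le ?_
  filter_upwards [h1, h2, Lp.coeFn_sub φ ψ, Lp.coeFn_sub u w] with x h1 h2 h3 h4
  rw [h3, h4, Pi.sub_apply, Pi.sub_apply, h1, h2, ← mul_sub, norm_mul, Complex.norm_real]
  exact mul_le_of_le_one_left (norm_nonneg _) (hm x)

/-- The Schwartz functions are a joint core of the position operators. -/
theorem exists_schwartz_seq_position {ψ : L2 d} {q : Fin d → L2 d}
    (h : ∀ j, (ψ, q j) ∈ (position d j).graph) :
    ∃ f : ℕ → 𝓢(ℝ^d, ℂ), Tendsto (fun n => (f n).toLp 2 volume) atTop (𝓝 ψ) ∧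
      ∀ j, Tendsto (fun n => (SchwartzMap.smulLeftCLM ℂ (fun x : ℝ^d => x j) (f n)).toLp 2 volume)
        atTop (𝓝 (q j)) := by
  -- Approximate `w = (1 + |x|²)^{1/2} ψ` by Schwartz functions and multiply back by `W = (1 +
  -- |x|²)^{-1/2}`. As `W` and every `x_j W` are bounded by `1`, one sequence serves all
  -- coordinates.
  obtain ⟨w, hw⟩ := LinearPMap.mem_domain_iff.mp
    (forall_coord_mem_domain_iff.mp fun j => LinearPMap.mem_domain_iff.mpr ⟨_, h j⟩)
  rw [mem_graph_mulOp] at hw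
  obtain ⟨u, hu, hlim⟩ := mem_closure_iff_seq_limit.mp (dense_schwartzSubmodule d w)
  choose v hv using hu
  have hv : ∀ n, (v n).toLp 2 volume = u n := hv
  set W : (ℝ^d) → ℝ := fun x => (1 + ‖x‖ ^ 2) ^ (-1 / 2 : ℝ) with hWdef
  have hW : W.HasTemperateGrowth := by fun_prop
  have hWW : ∀ x : ℝ^d, W x * (1 + ‖x‖ ^ 2) ^ (1 / 2 : ℝ) = 1 := fun x => by
    rw [hWdef, ← Real.rpow_add (by positivity)]
    norm_num
  have hWpos : ∀ x, 0 ≤ W x := fun x => by rw [hWdef]; positivity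
  have hW1 : ∀ x, |W x| ≤ 1 := fun x => by
    rw [abs_of_nonneg (hWpos x)]
    exact Real.rpow_le_one_of_one_le_of_nonpos (by nlinarith [norm_nonneg x]) (by norm_num)
  have hWj : ∀ j : Fin d, ∀ x : ℝ^d, |x j * W x| ≤ 1 := fun j x => by
    rw [abs_mul, abs_of_nonneg (hWpos x), ← hWW x, mul_comm]
    exact mul_le_mul_of_nonneg_left
      ((PiLp.norm_apply_le x j).trans (norm_le_one_add_norm_sq_rpow x)) (hWpos x)
  have hlim0 := tendsto_iff_norm_sub_tendsto_zero.mp hlim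
  have hψ : ∀ᵐ x, ψ x = W x * w x := by
    filter_upwards [hw] with x hx
    rw [hx, ← mul_assoc, ← Complex.ofReal_mul, hWW, Complex.ofReal_one, one_mul]
  have hf : ∀ n, ∀ᵐ x, ((SchwartzMap.smulLeftCLM ℂ W (v n)).toLp 2 volume : L2 d) x =
      W x * u n x := fun n => by
    rw [← hv n]
    exact mem_graph_mulOp.mp (toLp_mem_graph_mulOp hW (v n))
  refine ⟨fun n => SchwartzMap.smulLeftCLM ℂ W (v n), ?_, fun j => ?_⟩
  · rw [tendsto_iff_norm_sub_tendsto_zero]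
    exact squeeze_zero (fun n => norm_nonneg _)
      (fun n => norm_sub_le_of_mul hW1 (hf n) hψ) hlim0
  · rw [tendsto_iff_norm_sub_tendsto_zero]
    refine squeeze_zero (fun n => norm_nonneg _)
      (fun n => norm_sub_le_of_mul (hWj j) ?_ ?_) hlim0
    · filter_upwards [hf n, mem_graph_mulOp.mp (toLp_mem_graph_position j
        (SchwartzMap.smulLeftCLM ℂ W (v n)))] with x h1 h2
      rw [h2, h1, Complex.ofReal_mul, mul_assoc]
    · filter_upwards [hψ, mem_graph_mulOp.mp (h j)] with x h1 h2
      rw [h2, h1, Complex.ofReal_mul, mul_assoc]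

theorem mem_graph_heisenberg_position (t : ℝ) (j : Fin d) {ψ q m : L2 d}
    (hq : (ψ, q) ∈ (position d j).graph) (hm : (ψ, m) ∈ (momentum d j).graph) :
    (ψ, q + (t : ℂ) • m) ∈ (heisenberg (freePropagator d) (position d j) t).graph := by
  have hU := isPropagator_freePropagator d
  rw [hU.heisenberg_eq, mem_graph_conjOp]
  refine heisenberg_of_core (dualCore_position j) (dualCore_momentum j).symm (hU.unitary t) t
    (fun χ hχ => freePropagator_mem_schwartzSubmodule (-t) hχ) ?_ hq hm
  rintro _ ⟨f, rfl⟩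
  exact position_freePropagator_of_schwartz t j f

theorem vec_add_le_vecHeisenberg (t : ℝ) :
    vec (position d) + (t : ℂ) • vec (momentum d) ≤
      vecHeisenberg (freePropagator d) (position d) t := by
  refine le_of_forall_mem_graph fun ψ y hy => ?_
  obtain ⟨a, b, ha, hb, rfl⟩ := mem_graph_add.mp hy
  obtain ⟨b, hb', rfl⟩ := mem_graph_smul.mp hb
  rw [mem_graph_vec] at ha hb'
  exact mem_graph_vec.mpr fun j => mem_graph_heisenberg_position t j (ha j) (hb' j)

/-- `Q(t)` is unitarily equivalent to `Q`: approximate `U t ψ` in the joint graph norm by Schwartz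
functions and pull back by `U (-t)`. The approximants remain Schwartz, hence lie in `D(Q) ∩ D(Ξ)`.
-/
theorem closure_vec_add (t : ℝ) :
    (vec (position d) + (t : ℂ) • vec (momentum d)).closure =
      vecHeisenberg (freePropagator d) (position d) t := by
  have hU := isPropagator_freePropagator d
  refine closure_eq_of_graph_subset ?_ (vec_add_le_vecHeisenberg t) fun x y hxy => ?_
  · refine vec_isClosed fun j => ?_
    rw [hU.heisenberg_eq]
    exact ((dualCore_position j).conjOp _).isSelfAdjoint.isClosed
  have hxy' : ∀ j, (hU.unitary t x, hU.unitary t (y j)) ∈ (position d j).graph := fun j => by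
    have := mem_graph_vec.mp hxy j
    rwa [hU.heisenberg_eq, mem_graph_conjOp] at this
  obtain ⟨f, hf, hfj⟩ := exists_schwartz_seq_position hxy'
  refine mem_closure_iff_seq_limit.mpr ⟨fun n => ((hU.unitary t).symm ((f n).toLp 2 volume),
    WithLp.toLp 2 fun j => (hU.unitary t).symm
      ((SchwartzMap.smulLeftCLM ℂ (fun x : ℝ^d => x j) (f n)).toLp 2 volume)), fun n => ?_, ?_⟩
  · obtain ⟨h, hh⟩ := freePropagator_mem_schwartzSubmodule (-t)
      (show (f n).toLp 2 volume ∈ schwartzSubmodule d from ⟨f n, rfl⟩)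
    have hh : h.toLp 2 volume = (hU.unitary t).symm ((f n).toLp 2 volume) := hh
    have key := fun j => position_freePropagator_of_schwartz t j h
    rw [hh] at key
    choose q m hq hm hqm using key
    have hval : ∀ j, q j + (t : ℂ) • m j = (hU.unitary t).symm
        ((SchwartzMap.smulLeftCLM ℂ (fun x : ℝ^d => x j) (f n)).toLp 2 volume) := fun j => by
      apply (hU.unitary t).injective
      rw [LinearIsometryEquiv.apply_symm_apply]
      exact LinearPMap.mem_graph_snd_inj _ (hqm j) (toLp_mem_graph_position j (f n))
        ((hU.unitary t).apply_symm_apply _)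
    refine mem_graph_add.mpr ⟨WithLp.toLp 2 q, _, mem_graph_vec.mpr hq,
      mem_graph_smul.mpr ⟨WithLp.toLp 2 m, mem_graph_vec.mpr hm, rfl⟩, ?_⟩
    ext1 j
    exact hval j
  · refine Tendsto.prodMk_nhds ?_ ?_
    · have := ((hU.unitary t).symm.continuous.tendsto _).comp hf
      rwa [LinearIsometryEquiv.symm_apply_apply] at this
    · have h1 : Tendsto (fun n => fun j => (hU.unitary t).symm
          ((SchwartzMap.smulLeftCLM ℂ (fun x : ℝ^d => x j) (f n)).toLp 2 volume)) atTop
          (𝓝 fun j => y j) := by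
        rw [tendsto_pi_nhds]
        intro j
        have := ((hU.unitary t).symm.continuous.tendsto _).comp (hfj j)
        rwa [LinearIsometryEquiv.symm_apply_apply] at this
      exact ((PiLp.continuous_toLp 2 fun _ : Fin d => L2 d).tendsto _).comp h1

end Continuum

/-! ### Bounded exponentials and a closed operator -/

section Exponential

variable {E : Type*} [NormedAddCommGroup E] [InnerProductSpace ℂ E] [CompleteSpace E]

open NormedSpace in
/-- If `[Q, x] = y` on `D(Q)` with bounded commuting `x`, `y`, then `Q e^x = e^x (Q + y)` there. -/
theorem exp_mem_graph {Q : E →ₗ.[ℂ] E} (hQ : Q.IsClosed) {x y : E →L[ℂ] E} (hxy : Commute x y)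
    (h : ∀ ψ q, (ψ, q) ∈ Q.graph → (x ψ, x q + y ψ) ∈ Q.graph) {ψ q : E}
    (hψ : (ψ, q) ∈ Q.graph) : (exp x ψ, exp x (q + y ψ)) ∈ Q.graph := by
  -- Since `x` and `y` commute, `Q xⁿ = xⁿ Q + n xⁿ⁻¹ y`. The truncated `n - 1` at `n = 0` is
  -- harmless, its coefficient being `0`.
  have hpow : ∀ n : ℕ, ((x ^ n) ψ, (x ^ n) q + (n : ℂ) • (x ^ (n - 1)) (y ψ)) ∈ Q.graph := by
    intro n
    induction n with
    | zero => simpa using hψ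
    | succ n ih =>
      have h1 := h _ _ ih
      have h2 : y ((x ^ n) ψ) = (x ^ n) (y ψ) :=
        (DFunLike.congr_fun (hxy.pow_left n).eq ψ).symm
      have h3 : (n : ℂ) • x ((x ^ (n - 1)) (y ψ)) = (n : ℂ) • (x ^ n) (y ψ) := by
        rcases n with _ | n
        · simp
        · rw [Nat.add_sub_cancel, pow_succ' x n]; rfl
      convert h1 using 2
      · rw [pow_succ']; rfl
      · rw [map_add, map_smul, h3, h2, Nat.add_sub_cancel, pow_succ']
        push_cast
        rw [add_smul, one_smul, ← add_assoc]
        rfl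
  have hsum : HasSum (fun n : ℕ => ((n.factorial : ℂ)⁻¹) • x ^ n) (exp x) :=
    exp_series_hasSum_exp' (𝕂 := ℂ) x
  have happ : ∀ u : E, HasSum (fun n : ℕ => ((n.factorial : ℂ)⁻¹) • (x ^ n) u) (exp x u) :=
    fun u => hsum.mapL (ContinuousLinearMap.apply ℂ E u)
  have hshift : HasSum (fun n : ℕ => ((n.factorial : ℂ)⁻¹) • (n : ℂ) • (x ^ (n - 1)) (y ψ))
      (exp x (y ψ)) := by
    -- The term `n = 0` vanishes, and `(n + 1)/(n + 1)! = 1/n!`.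
    rw [← hasSum_nat_add_iff' 1]
    simp only [Finset.range_one, Finset.sum_singleton, Nat.cast_zero, zero_smul, smul_zero,
      sub_zero, Nat.add_sub_cancel]
    convert happ (y ψ) using 2 with n
    rw [smul_smul, Nat.factorial_succ]
    congr 1
    have h1 : ((n : ℂ) + 1) ≠ 0 := Nat.cast_add_one_ne_zero n
    push_cast
    field_simp
  have h2 := (happ ψ).prodMk ((happ q).add hshift)
  rw [← map_add] at h2
  refine hQ.mem_of_tendsto h2 (Eventually.of_forall fun s => Submodule.sum_mem _ fun n _ => ?_)
  convert Q.graph.smul_mem ((n.factorial : ℂ)⁻¹) (hpow n) using 1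
  simp [smul_add]

end Exponential

/-! ### Position, translations and hopping on `ℓ²(ℤ^d)` -/

section Lattice

variable {d : ℕ}

local notation "⟪" x ", " y "⟫" => inner ℂ x y

theorem mem_graph_latticePosition {j : Fin d} {ψ q : l2 d} :
    (ψ, q) ∈ (latticePosition d j).graph ↔ ∀ n, q n = ((n j : ℤ) : ℂ) * ψ n := by
  rw [mem_graph_iff_exists]
  constructor
  · rintro ⟨h, rfl⟩ n
    rfl
  · intro h
    have h' : (fun n : Fin d → ℤ => ((n j : ℤ) : ℂ) * ψ n) = q := funext fun n => (h n).symm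
    have hd : ψ ∈ (latticePosition d j).domain := by
      change Memℓp (fun n : Fin d → ℤ => ((n j : ℤ) : ℂ) * ψ n) 2
      rw [h']
      exact q.2
    exact ⟨hd, lp.ext h'⟩

theorem single_mem_graph_latticePosition (j : Fin d) (n : Fin d → ℤ) :
    (lp.single 2 n (1 : ℂ), ((n j : ℤ) : ℂ) • lp.single 2 n (1 : ℂ)) ∈
      (latticePosition d j).graph := by
  rw [mem_graph_latticePosition]
  intro m
  rcases eq_or_ne m n with rfl | h
  · simp
  · simp [h]

theorem dense_latticePosition_domain (j : Fin d) :
    Dense ((latticePosition d j).domain : Set (l2 d)) := by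
  rw [Submodule.dense_iff_topologicalClosure_eq_top, Submodule.topologicalClosure_eq_top_iff,
    Submodule.eq_bot_iff]
  intro φ hφ
  rw [Submodule.mem_orthogonal] at hφ
  ext n
  have := hφ _ (LinearPMap.mem_domain_iff.mpr ⟨_, single_mem_graph_latticePosition j n⟩)
  rw [lp.inner_single_left] at this
  simpa using this

/-- Testing against the point masses reads off each coordinate. The whole domain serves as core,
since the bounded momentum accepts any dense subspace. -/
theorem dualCore_latticePosition (j : Fin d) :
    DualCore (latticePosition d j) (latticePosition d j).domain where
  dense := dense_latticePosition_domain j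
  le := le_rfl
  symm := by
    intro x x' y y' hx hy
    rw [mem_graph_latticePosition] at hx hy
    rw [lp.inner_eq_tsum, lp.inner_eq_tsum]
    congr 1
    ext n
    rw [hx, hy]
    simp
    ring
  dual := by
    intro ψ φ H
    rw [mem_graph_latticePosition]
    intro n
    have hs := single_mem_graph_latticePosition j n
    have := H _ (LinearPMap.mem_domain_iff.mpr ⟨_, hs⟩) _ hs
    rw [inner_smul_right, lp.inner_single_right, lp.inner_single_right] at this
    apply (starRingEnd ℂ).injective
    simpa using this

theorem translation_inner (a : Fin d → ℤ) (ψ φ : l2 d) :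
    ⟪translation d a ψ, φ⟫ = ⟪ψ, translation d (-a) φ⟫ := by
  rw [lp.inner_eq_tsum, lp.inner_eq_tsum]
  refine Eq.trans (tsum_congr fun n => ?_)
    ((Equiv.addRight a).tsum_eq fun n => ⟪ψ n, translation d (-a) φ n⟫)
  change ⟪ψ (n + a), φ n⟫ = ⟪ψ (n + a), φ (n + a + -a)⟫
  rw [add_neg_cancel_right]

theorem translation_comm (a b : Fin d → ℤ) (ψ : l2 d) :
    translation d a (translation d b ψ) = translation d b (translation d a ψ) := by
  ext n
  change ψ (n + a + b) = ψ (n + b + a)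
  rw [add_right_comm]

theorem isSymmetric_neighborSum (d : ℕ) : (neighborSum d).IsSymmetric := by
  intro ψ φ
  simp only [neighborSum, LinearMap.sum_apply, LinearMap.add_apply, sum_inner, inner_sum,
    inner_add_left, inner_add_right, translation_inner, neg_neg]
  exact Finset.sum_congr rfl fun k _ => add_comm _ _

/-- `ψ ↦ i (ψ(· + e_j) - ψ(· - e_j))`. -/
def hoppingMomentum (j : Fin d) : l2 d →ₗ[ℂ] l2 d :=
  Complex.I • (translation d (Pi.single j 1) - translation d (-Pi.single j 1))

theorem isSymmetric_hoppingMomentum (j : Fin d) : (hoppingMomentum j).IsSymmetric := by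
  intro ψ φ
  simp only [hoppingMomentum, LinearMap.smul_apply, LinearMap.sub_apply, inner_smul_left,
    inner_smul_right, inner_sub_left, inner_sub_right, translation_inner, neg_neg, Complex.conj_I]
  ring

theorem hoppingMomentum_neighborSum (j : Fin d) (ψ : l2 d) :
    hoppingMomentum j (neighborSum d ψ) = neighborSum d (hoppingMomentum j ψ) := by
  simp only [hoppingMomentum, neighborSum, LinearMap.smul_apply, LinearMap.sub_apply,
    LinearMap.sum_apply, LinearMap.add_apply, map_sum, map_add, map_smul, map_sub, smul_sub,
    smul_add, ← Finset.sum_sub_distrib, Finset.smul_sum]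
  refine Finset.sum_congr rfl fun k _ => ?_
  rw [translation_comm (Pi.single j 1), translation_comm (Pi.single j 1),
    translation_comm (-Pi.single j 1), translation_comm (-Pi.single j 1)]
  abel

theorem translation_mem_graph (a : Fin d → ℤ) {j : Fin d} {ψ q : l2 d}
    (h : (ψ, q) ∈ (latticePosition d j).graph) :
    (translation d a ψ, translation d a q - ((a j : ℤ) : ℂ) • translation d a ψ) ∈
      (latticePosition d j).graph := by
  rw [mem_graph_latticePosition] at h ⊢
  intro n
  change q (n + a) - ((a j : ℤ) : ℂ) * ψ (n + a) = ((n j : ℤ) : ℂ) * ψ (n + a)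
  rw [h]
  simp only [Pi.add_apply]
  push_cast
  ring

/-- A translation by `a` contributes `-a_j T_a` to the commutator with `Q_j`, so only the steps
`±e_j` survive, and `-(T_{e_j} - T_{-e_j})` is `i` times `hoppingMomentum j`. -/
theorem neighborSum_mem_graph {j : Fin d} {ψ q : l2 d}
    (h : (ψ, q) ∈ (latticePosition d j).graph) :
    (neighborSum d ψ, neighborSum d q + Complex.I • hoppingMomentum j ψ) ∈
      (latticePosition d j).graph := by
  have h1 := Submodule.sum_mem (latticePosition d j).graph (t := Finset.univ) fun k _ =>
    (latticePosition d j).graph.add_mem (translation_mem_graph (Pi.single k 1) h)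
      (translation_mem_graph (-Pi.single k 1) h)
  convert h1 using 1
  rw [Prod.ext_iff, Prod.fst_sum, Prod.snd_sum]
  constructor
  · simp [neighborSum]
  · simp only [Prod.snd_add, neighborSum, LinearMap.sum_apply, LinearMap.add_apply,
      Finset.sum_add_distrib, Finset.sum_sub_distrib, Pi.neg_apply, Pi.single_apply,
      hoppingMomentum, LinearMap.smul_apply, LinearMap.sub_apply, smul_smul, Complex.I_mul_I]
    simp
    abel

end Lattice

/-! ### Propagators of bounded Hamiltonians -/

section BoundedPropagator

variable {E : Type*} [NormedAddCommGroup E] [InnerProductSpace ℂ E] [CompleteSpace E]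

open NormedSpace in
/-- `t ↦ e^{-ith}` is the propagator of a bounded self-adjoint operator `h`. -/
theorem isPropagator_exp {h : E →L[ℂ] E} (hh : (h : E →ₗ[ℂ] E).IsSymmetric) :
    IsPropagator ((h : E →ₗ[ℂ] E).toPMap ⊤) (fun t => exp (t • ((-Complex.I) • h))) := by
  have hd : ∀ t ψ, HasDerivAt (fun t : ℝ => exp (t • ((-Complex.I) • h)) ψ)
      (exp (t • ((-Complex.I) • h)) (((-Complex.I) • h) ψ)) t := fun t ψ =>
    ((ContinuousLinearMap.apply ℂ E ψ).restrictScalars ℝ).hasFDerivAt.comp_hasDerivAt t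
      (hasDerivAt_exp_smul_const (𝕂 := ℝ) ((-Complex.I) • h) t)
  have hsa : IsSelfAdjoint h := ContinuousLinearMap.isSelfAdjoint_iff_isSymmetric.mpr hh
  have hs : ∀ t : ℝ, t • ((-Complex.I) • h) ∈ skewAdjoint (E →L[ℂ] E) := fun t => by
    rw [skewAdjoint.mem_iff, star_smul, star_smul, hsa.star_eq, star_neg, Complex.star_def,
      Complex.conj_I, star_trivial, neg_neg, neg_smul, smul_neg, neg_neg]
  have hu : ∀ t : ℝ, exp (t • ((-Complex.I) • h)) ∈ unitary (E →L[ℂ] E) := fun t => by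
    let +nondep : NormedAlgebra ℚ (E →L[ℂ] E) := .restrictScalars ℚ ℂ _
    exact exp_mem_unitary_of_mem_skewAdjoint (hs t)
  refine IsPropagator.of_hasDerivAt (C := ⊤) (DualCore.toPMap_top hh (by simp)) (by simp)
    (fun s t => ?_) (fun t ψ => ?_) (fun ψ => ?_) fun ψ φ hφ => ?_
  · let +nondep : NormedAlgebra ℚ (E →L[ℂ] E) := .restrictScalars ℚ ℂ _
    rw [add_smul]
    exact exp_add_of_commute (((Commute.refl _).smul_left s).smul_right t)
  · exact ContinuousLinearMap.norm_map_of_mem_unitary (hu t) ψ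
  · exact continuous_iff_continuousAt.mpr fun t => (hd t ψ).continuousAt
  · rw [mem_graph_toPMap_top] at hφ
    have := hd 0 ψ
    rw [zero_smul, exp_zero] at this
    rw [← hφ]
    exact this

end BoundedPropagator

/-! ### Ballistic motion on the lattice, both normalizations as `a + bN` -/

section Lattice

variable {d : ℕ}

/-- `a + b N` with `N` the sum over nearest neighbours. -/
def affineHopping (d : ℕ) (a b : ℝ) : l2 d →ₗ[ℂ] l2 d :=
  (a : ℂ) • LinearMap.id + (b : ℂ) • neighborSum d

theorem isSymmetric_affineHopping (a b : ℝ) : (affineHopping d a b).IsSymmetric :=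
  (LinearMap.IsSymmetric.id.smul (Complex.conj_ofReal a)).add
    ((isSymmetric_neighborSum d).smul (Complex.conj_ofReal b))

theorem isSymmetric_smul_hoppingMomentum (b : ℝ) (j : Fin d) :
    ((b : ℂ) • hoppingMomentum j).IsSymmetric :=
  (isSymmetric_hoppingMomentum j).smul (Complex.conj_ofReal b)

theorem affineHopping_mem_graph (a b : ℝ) {j : Fin d} {ψ q : l2 d}
    (h : (ψ, q) ∈ (latticePosition d j).graph) :
    (affineHopping d a b ψ,
      affineHopping d a b q + Complex.I • ((b : ℂ) • hoppingMomentum j) ψ) ∈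
      (latticePosition d j).graph := by
  have := (latticePosition d j).graph.add_mem ((latticePosition d j).graph.smul_mem (a : ℂ) h)
    ((latticePosition d j).graph.smul_mem (b : ℂ) (neighborSum_mem_graph h))
  convert this using 1
  simp only [affineHopping, LinearMap.add_apply, LinearMap.smul_apply, LinearMap.id_apply,
    Prod.smul_mk, Prod.mk_add_mk, smul_add, smul_comm Complex.I, add_assoc]

theorem latticeMomentum_eq (a b : ℝ) (j : Fin d) :
    latticeMomentum d ((affineHopping d a b).toPMap ⊤) j =
      ((b : ℂ) • hoppingMomentum j).toPMap ⊤ := by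
  refine maxCommutator_eq (DualCore.toPMap_top (isSymmetric_smul_hoppingMomentum b j)
    (dense_latticePosition_domain j)) (dualCore_latticePosition j).symm
    (DualCore.toPMap_top (C := ⊤) (isSymmetric_affineHopping a b) (by simp)).symm
    fun χ hχ => ⟨_, mem_graph_toPMap_top.mpr rfl, ?_⟩
  obtain ⟨q, hq⟩ := LinearPMap.mem_domain_iff.mp hχ
  exact mem_graph_commutator.mpr ⟨_, _, _, _, mem_graph_toPMap_top.mpr rfl,
    affineHopping_mem_graph a b hq, hq, mem_graph_toPMap_top.mpr rfl, add_sub_cancel_left _ _⟩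

/-- `a + b N` as a bounded operator. -/
def latticeHoppingL (d : ℕ) (a b : ℝ) : l2 d →L[ℂ] l2 d :=
  -- Boundedness comes from Hellinger–Toeplitz: an everywhere defined symmetric operator is
  -- continuous.
  ⟨affineHopping d a b, (isSymmetric_affineHopping a b).continuous⟩

/-- The momentum as a bounded operator. -/
def hoppingMomentumL (b : ℝ) (j : Fin d) : l2 d →L[ℂ] l2 d :=
  ⟨(b : ℂ) • hoppingMomentum j, (isSymmetric_smul_hoppingMomentum b j).continuous⟩

theorem commute_latticeHoppingL (a b : ℝ) (j : Fin d) :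
    Commute (latticeHoppingL d a b) (hoppingMomentumL b j) := by
  ext1 ψ
  change affineHopping d a b (((b : ℂ) • hoppingMomentum j) ψ) =
    ((b : ℂ) • hoppingMomentum j) (affineHopping d a b ψ)
  simp only [affineHopping, LinearMap.add_apply, LinearMap.smul_apply, LinearMap.id_apply,
    map_add, map_smul, hoppingMomentum_neighborSum, smul_add]
  simp only [smul_comm (a : ℂ)]

theorem isPropagator_lattice (a b : ℝ) :
    IsPropagator ((affineHopping d a b).toPMap ⊤)
      (fun t => NormedSpace.exp (t • ((-Complex.I) • latticeHoppingL d a b))) :=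
  isPropagator_exp (h := latticeHoppingL d a b) (isSymmetric_affineHopping a b)

/-- Apply `exp_mem_graph` with `x = -ith`, where `h = a + bN`: its commutator with `Q_j` is `-it ·
i` times the momentum, that is, `t` times the momentum. -/
theorem exp_lattice_mem_graph (a b t : ℝ) {j : Fin d} {ψ q : l2 d}
    (h : (ψ, q) ∈ (latticePosition d j).graph) :
    (NormedSpace.exp (t • ((-Complex.I) • latticeHoppingL d a b)) ψ,
      NormedSpace.exp (t • ((-Complex.I) • latticeHoppingL d a b))
        (q + (t : ℂ) • ((b : ℂ) • hoppingMomentum j) ψ)) ∈ (latticePosition d j).graph := by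
  refine exp_mem_graph (y := t • hoppingMomentumL b j)
    (dualCore_latticePosition j).isSelfAdjoint.isClosed ?_ (fun ψ q h => ?_) h
  · exact (((commute_latticeHoppingL a b j).smul_left _).smul_left t).smul_right t
  · have := (latticePosition d j).graph.smul_mem ((t : ℂ) * (-Complex.I))
      (affineHopping_mem_graph a b h)
    convert this using 1
    rw [Prod.smul_mk, smul_add, smul_smul _ Complex.I, mul_assoc, neg_mul, Complex.I_mul_I,
      neg_neg, mul_one, mul_smul, mul_smul]
    rfl

theorem heisenberg_lattice (a b t : ℝ) (j : Fin d) :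
    heisenberg (fun t => NormedSpace.exp (t • ((-Complex.I) • latticeHoppingL d a b)))
        (latticePosition d j) t =
      latticePosition d j +
        (t : ℂ) • latticeMomentum d ((affineHopping d a b).toPMap ⊤) j := by
  have hU := isPropagator_lattice (d := d) a b
  rw [hU.heisenberg_eq, latticeMomentum_eq]
  refine eq_of_forall_mem_graph_iff fun ψ r => ?_
  rw [mem_graph_conjOp, mem_graph_add]
  constructor
  · intro h
    -- The relation at time `-t`, applied to `U t ψ`, shows `ψ ∈ D(Q_j)`; this is the inclusion of
    -- domains that gives equality rather than closure.
    have h1 := exp_lattice_mem_graph a b (-t) h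
    have e1 : NormedSpace.exp ((-t) • ((-Complex.I) • latticeHoppingL d a b))
      (hU.unitary t ψ) = ψ := hU.neg_apply_apply t ψ
    rw [e1] at h1
    exact ⟨_, _, h1, mem_graph_smul.mpr ⟨_, mem_graph_toPMap_top.mpr rfl, rfl⟩,
      (hU.unitary t).injective (LinearPMap.mem_graph_snd_inj _
        (exp_lattice_mem_graph a b t h1) h rfl)⟩
  · rintro ⟨q, m, hq, hm, rfl⟩
    obtain ⟨m, hm', rfl⟩ := mem_graph_smul.mp hm
    rw [← mem_graph_toPMap_top.mp hm']
    exact exp_lattice_mem_graph a b t hq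

theorem vec_heisenberg_lattice (a b t : ℝ) :
    vecHeisenberg (fun t => NormedSpace.exp (t • ((-Complex.I) • latticeHoppingL d a b)))
        (latticePosition d) t =
      vec (latticePosition d) +
        (t : ℂ) • vec (latticeMomentum d ((affineHopping d a b).toPMap ⊤)) := by
  refine eq_of_forall_mem_graph_iff fun ψ r => ?_
  rw [vecHeisenberg, mem_graph_vec, mem_graph_add]
  simp only [heisenberg_lattice, mem_graph_add, mem_graph_smul]
  constructor
  · intro h
    choose q m hq hm hqm using h
    choose m' hm' hmm' using hm
    refine ⟨WithLp.toLp 2 q, _, mem_graph_vec.mpr hq, ⟨WithLp.toLp 2 m', mem_graph_vec.mpr hm',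
      rfl⟩, ?_⟩
    ext1 j
    rw [← hqm j, ← hmm' j]
    rfl
  · rintro ⟨q, _, hq, ⟨m, hm, rfl⟩, rfl⟩ j
    exact ⟨q j, _, mem_graph_vec.mp hq j, ⟨m j, mem_graph_vec.mp hm j, rfl⟩, rfl⟩

theorem latticeHamiltonian_eq (d : ℕ) :
    latticeHamiltonian d = (affineHopping d (2 * d) (-1)).toPMap ⊤ := by
  rw [latticeHamiltonian, affineHopping]
  congr 1
  push_cast
  rw [neg_smul, one_smul, sub_eq_add_neg]

theorem latticeHopping_eq (d : ℕ) :
    latticeHopping d = (affineHopping d 0 1).toPMap ⊤ := by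
  rw [latticeHopping, affineHopping]
  simp

theorem ballistic_lattice (a b : ℝ) (H : l2 d →ₗ.[ℂ] l2 d)
    (hH : H = (affineHopping d a b).toPMap ⊤) :
    (vec (latticeMomentum d H)).domain = ⊤ ∧ (∃! U, IsPropagator H U) ∧
    ∀ U, IsPropagator H U →
      (∀ t : ℝ, vecHeisenberg U (latticePosition d) t =
        vec (latticePosition d) + (t : ℂ) • vec (latticeMomentum d H)) ∧
      (∀ (ψ : l2 d) (_ : ψ ∈ (vec (latticePosition d)).domain)
        (hΞ : ψ ∈ (vec (latticeMomentum d H)).domain),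
        ∃ h : ∀ t, ψ ∈ (vecHeisenberg U (latticePosition d) t).domain,
          Tendsto (fun t : ℝ => (t : ℂ)⁻¹ • vecHeisenberg U (latticePosition d) t ⟨ψ, h t⟩)
            atTop (𝓝 (vec (latticeMomentum d H) ⟨ψ, hΞ⟩))) ∧
      ∀ j, StrongResolventTendsto
        (fun t : ℝ => (t : ℂ)⁻¹ • heisenberg U (latticePosition d j) t) atTop
        (latticeMomentum d H j) := by
  subst hH
  have hU₀ := isPropagator_lattice (d := d) a b
  have hdense : Dense (((affineHopping d a b).toPMap ⊤).domain : Set (l2 d)) := by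
    simp
  refine ⟨?_, ⟨_, hU₀, fun U hU => hU.eq hU₀ hdense⟩, fun U hU => ?_⟩
  · rw [Submodule.eq_top_iff']
    intro ψ
    rw [mem_vec_domain]
    intro j
    rw [latticeMomentum_eq]
    trivial
  obtain rfl := hU.eq hU₀ hdense
  refine ⟨vec_heisenberg_lattice a b, fun ψ hQ hΞ =>
    tendsto_inv_smul_vecHeisenberg (fun t => (vec_heisenberg_lattice a b t).ge) ψ hQ hΞ,
    fun j => ?_⟩
  refine strongResolventTendsto_heisenberg hU₀ (dualCore_latticePosition j) ?_
    fun t ψ q m hq hm => ?_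
  · rw [latticeMomentum_eq]
    exact DualCore.toPMap_top (isSymmetric_smul_hoppingMomentum b j)
      (dense_latticePosition_domain j)
  · rw [heisenberg_lattice]
    exact mem_graph_add.mpr ⟨_, _, hq, mem_graph_smul.mpr ⟨_, hm, rfl⟩, rfl⟩

end Lattice

end Ballistic

end

/-! ### The main theorem -/

theorem mainTheorem2 (d : ℕ) :
    -- the continuum `L²(ℝ^d)`
    ((∀ ψ : Ballistic.L2 d, ψ ∈ (Ballistic.vec (Ballistic.momentum d)).domain ↔
        TemperedDistribution.MemSobolev 1 2 (Ballistic.toDist d ψ)) ∧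
     (∃! U, Ballistic.IsPropagator (Ballistic.freeHamiltonian d) U) ∧
     ∀ U, Ballistic.IsPropagator (Ballistic.freeHamiltonian d) U →
       (∀ t : ℝ,
          Ballistic.vec (Ballistic.position d) + (t : ℂ) • Ballistic.vec (Ballistic.momentum d) ≤
            Ballistic.vecHeisenberg U (Ballistic.position d) t ∧
          (Ballistic.vec (Ballistic.position d) + (t : ℂ) • Ballistic.vec (Ballistic.momentum d)).closure =
            Ballistic.vecHeisenberg U (Ballistic.position d) t) ∧
       (∀ (ψ : Ballistic.L2 d) (_ : ψ ∈ (Ballistic.vec (Ballistic.position d)).domain)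
          (hΞ : ψ ∈ (Ballistic.vec (Ballistic.momentum d)).domain),
          ∃ h : ∀ t, ψ ∈ (Ballistic.vecHeisenberg U (Ballistic.position d) t).domain,
            Tendsto (fun t : ℝ => (t : ℂ)⁻¹ • Ballistic.vecHeisenberg U (Ballistic.position d) t ⟨ψ, h t⟩)
              atTop (𝓝 (Ballistic.vec (Ballistic.momentum d) ⟨ψ, hΞ⟩))) ∧
       ∀ j, Ballistic.StrongResolventTendsto
         (fun t : ℝ => (t : ℂ)⁻¹ • Ballistic.heisenberg U (Ballistic.position d j) t) atTop
         (Ballistic.momentum d j)) ∧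
    -- the lattice `ℓ²(ℤ^d)`, in both normalizations of the discrete Laplacian
    (∀ H ∈ ({Ballistic.latticeHamiltonian d, Ballistic.latticeHopping d} :
        Set (Ballistic.l2 d →ₗ.[ℂ] Ballistic.l2 d)),
     (Ballistic.vec (Ballistic.latticeMomentum d H)).domain = ⊤ ∧
     (∃! U, Ballistic.IsPropagator H U) ∧
     ∀ U, Ballistic.IsPropagator H U →
       (∀ t : ℝ, Ballistic.vecHeisenberg U (Ballistic.latticePosition d) t =
          Ballistic.vec (Ballistic.latticePosition d) + (t : ℂ) • Ballistic.vec (Ballistic.latticeMomentum d H)) ∧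
       (∀ (ψ : Ballistic.l2 d) (_ : ψ ∈ (Ballistic.vec (Ballistic.latticePosition d)).domain)
          (hΞ : ψ ∈ (Ballistic.vec (Ballistic.latticeMomentum d H)).domain),
          ∃ h : ∀ t, ψ ∈ (Ballistic.vecHeisenberg U (Ballistic.latticePosition d) t).domain,
            Tendsto (fun t : ℝ => (t : ℂ)⁻¹ • Ballistic.vecHeisenberg U (Ballistic.latticePosition d) t ⟨ψ, h t⟩)
              atTop (𝓝 (Ballistic.vec (Ballistic.latticeMomentum d H) ⟨ψ, hΞ⟩))) ∧
       ∀ j, Ballistic.StrongResolventTendsto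
         (fun t : ℝ => (t : ℂ)⁻¹ • Ballistic.heisenberg U (Ballistic.latticePosition d j) t) atTop
         (Ballistic.latticeMomentum d H j)) := by
  have hU₀ := Ballistic.isPropagator_freePropagator d
  have hdense := (Ballistic.dualCore_freeHamiltonian d).dense_domain
  refine ⟨⟨fun ψ => Ballistic.mem_vec_momentum_domain,
    ⟨_, hU₀, fun U hU => hU.eq hU₀ hdense⟩, fun U hU => ?_⟩, fun H hH => ?_⟩
  · obtain rfl := hU.eq hU₀ hdense
    exact ⟨fun t => ⟨Ballistic.vec_add_le_vecHeisenberg t, Ballistic.closure_vec_add t⟩,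
      fun ψ hQ hΞ => Ballistic.tendsto_inv_smul_vecHeisenberg
        Ballistic.vec_add_le_vecHeisenberg ψ hQ hΞ,
      fun j => Ballistic.strongResolventTendsto_heisenberg hU₀ (Ballistic.dualCore_position j)
        (Ballistic.dualCore_momentum j)
        fun t _ _ _ hq hm => Ballistic.mem_graph_heisenberg_position t j hq hm⟩
  · rcases hH with hH | hH
    · exact Ballistic.ballistic_lattice _ _ H (hH.trans (Ballistic.latticeHamiltonian_eq d))
    · exact Ballistic.ballistic_lattice _ _ H (hH.trans (Ballistic.latticeHopping_eq d))
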